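/- Let $R$ be a commutative ring, let $n, p \ge 0$ be integers, and let $x=(x_1,\dots,x_n)$ be indeterminates. For a partition $\lambda$ let $s_\lambda(x)=\sum_T \prod_{c\in\lambda} x_{T(c)} \in R[x_1,\dots,x_n]$ be the Schur polynomial, where $T$ runs over the semistandard Young tableaux of shape $\lambda$ with entries in $\{1,\dots,n\}$ (weakly increasing along rows, strictly increasing down columns). Let $F_p$ be the set of all partitions that in Frobenius notation have the form $$\eta=(\alpha_1+p,\dots,\alpha_r+p\,|\,\alpha_1,\dots,\alpha_r),\qquad r\ge 0,\quad \alpha_1>\dots>\alpha_r\ge 0,$$ that is, $\eta$ has exactly $r=r(\eta)$ diagonal boxes, and there are $\alpha_i+p$ boxes to the right of the $i$-th diagonal box and $\alpha_i$ boxes below it. Let $|\eta|$ be the number of boxes of $\eta$. Then $|\eta|-(p-1)r(\eta)$ is even for every $\eta\in F_p$, only finitely many terms of each of the two sums below are nonzero, and $$\sum_{\eta\in F_p}(-1)^{\frac12\left(|\eta|-(p-1)r(\eta)\right)}\,s_\eta(x)\;=\;\prod_{i=1}^n(1-x_i)\prod_{1\le i<j\le n}(1-x_ix_j)\sum_{\lambda:\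 \lambda_1\le p}s_\lambda(x)\qquad\text{in } R[x_1,\dots,x_n].$$ -/

import Mathlib

/-- The semistandard tableaux of shape `μ` all of whose entries lie in `{0, …, n - 1}`. -/
def BoundedSSYT (μ : YoungDiagram) (n : ℕ) : Type :=
  {T : SemistandardYoungTableau μ // ∀ i j, (i, j) ∈ μ → T i j < n}

/-- The entry of a bounded tableau in a cell of its shape, as an element of `Fin n`. -/
def BoundedSSYT.entryFin {μ : YoungDiagram} {n : ℕ} (T : BoundedSSYT μ n)
    (c : {c : ℕ × ℕ // c ∈ μ.cells}) : Fin n :=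
  ⟨T.1 c.1.1 c.1.2, T.2 c.1.1 c.1.2 c.2⟩

/-- A bounded tableau is determined by its entries in the cells of its shape. -/
theorem BoundedSSYT.entryFin_injective (μ : YoungDiagram) (n : ℕ) :
    Function.Injective (BoundedSSYT.entryFin (μ := μ) (n := n)) := by
  intro S T h
  apply Subtype.ext
  apply SemistandardYoungTableau.ext
  intro i j
  by_cases hc : (i, j) ∈ μ
  · exact congrArg Fin.val (congrFun h ⟨(i, j), hc⟩)
  · rw [S.1.zeros hc, T.1.zeros hc]

instance BoundedSSYT.instFinite (μ : YoungDiagram) (n : ℕ) : Finite (BoundedSSYT μ n) :=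
  Finite.of_injective _ (BoundedSSYT.entryFin_injective μ n)

noncomputable instance BoundedSSYT.instFintype (μ : YoungDiagram) (n : ℕ) :
    Fintype (BoundedSSYT μ n) :=
  Fintype.ofFinite _

/-- The Schur polynomial `s_μ(x_0, …, x_{n-1}) = ∑_T ∏_c x_{T(c)}`, the sum over all semistandard
tableaux `T` of shape `μ` with entries in `{0, …, n - 1}`, the product over the cells of `μ`. -/
noncomputable def schurPoly (R : Type*) [CommRing R] (n : ℕ) (μ : YoungDiagram) :
    MvPolynomial (Fin n) R :=
  ∑ T : BoundedSSYT μ n, ∏ c : {c : ℕ × ℕ // c ∈ μ.cells}, MvPolynomial.X (T.entryFin c)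

/-- The number of boxes on the main diagonal of `μ` (the rank in Frobenius notation). -/
def diagLen (μ : YoungDiagram) : ℕ :=
  (μ.cells.filter fun c => c.1 = c.2).card

/-- `μ = (a_1, …, a_r | b_1, …, b_r)` in Frobenius notation: `μ` has `r` diagonal boxes, and there
are `a_i` boxes to the right of, and `b_i` boxes below, the `i`-th diagonal box. (Rows, columns
and the index `i` are counted from `0` here.) -/
def HasFrobenius (μ : YoungDiagram) {r : ℕ} (a b : Fin r → ℕ) : Prop :=
  diagLen μ = r ∧ ∀ i : Fin r, μ.rowLen i = i + 1 + a i ∧ μ.colLen i = i + 1 + b i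

/-- The set `F_p` of the diagrams `(α_1 + p, …, α_r + p | α_1, …, α_r)` in Frobenius notation,
with `r ≥ 0` and `α_1 > ⋯ > α_r ≥ 0`. -/
def augmentedSelfConj (p : ℕ) : Set YoungDiagram :=
  {μ | ∃ (r : ℕ) (α : Fin r → ℕ), StrictAnti α ∧ HasFrobenius μ (fun i => α i + p) α}

/-!
The bounded sum of Schur polynomials on the right-hand side is evaluated as a quotient of
determinants, and the numerator is then expanded into alternants.

Let `N = n + p`, let `V` be the Vandermonde determinant of `x` and put
`W = ∏ (1 - x_i) ∏_{i < j} (1 - x_i x_j)` (`denomB`) and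
`E = det (x_i ^ j - x_i ^ (N + n - 1 - j))` (`altB`), where `0 ≤ i, j < n`.

* By `det_rowLen_eq`, `s_μ V` is the alternant with exponents `μ_i + n - 1 - i`. The proof removes
  the largest variable on both sides: from tableaux this strips a horizontal strip
  (`schurEval_succ`), and for determinants it is a column operation (`det_pow_succ`). Hence
  `V ∑_{μ_1 ≤ p} s_μ` is the sum `D` of all alternants with exponents below `N` (`altSum_eq`).

* `D W = E` over a field, for points in general position (`altSum_mul_denomB`). Splitting the
  exponent sets according to whether they contain the largest exponent gives a recursion for `D`
  in `n` and `N` (`altSum_succ`). For `E` the corresponding recursion `altB_succ` is checked on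
  each term of the row expansion of `E` (`altB_eq_sum_vandermonde`), whose terms are Vandermonde
  determinants with some of the variables inverted. There it reduces to
  `∑_{a ∈ s} (1 - a) ∏_{b ≠ a} (1 - a b) / (b - a) = 1 - ∏_{a ∈ s} a`, which is an instance of
  Lagrange interpolation (`sum_one_sub_mul_prod_div`).

* The column expansion of `E` is a signed sum of alternants indexed by the sets `S` of columns in
  which the second term is chosen. Sorting the exponents gives a partition `flipDiagram p S`, and
  its Frobenius coordinates are read off from its set of exponents `B`: the elements of `B` that
  are at least `n` are `n + a` for the arm lengths `a`, and the numbers below `n` that are missing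
  from `B` are `n - 1 - b` for the leg lengths `b` (`exists_rowLen_add_eq_iff_arm`,
  `forall_rowLen_add_ne_iff_leg`). So `flipDiagram p` is a bijection from the subsets of
  `{0, …, n - 1}` to the partitions in `augmentedSelfConj p` with at most `n` rows, and the sign of
  the sorting permutation yields the sign in the identity (`altB_eq_sum_flipDiagrams`).

Cancelling `V` proves the identity in the fraction field of `ℤ[x_0, …, x_{n-1}]`, whence it holds
over every commutative ring.
-/

/-! ### The type B denominator -/

/-- Lagrange interpolation of `∏_{b ∈ s} (1 - b t)` at the nodes `s ∪ {-1}`, read off in the top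
coefficient. -/
theorem sum_one_sub_mul_prod_div {K : Type*} [Field K] [DecidableEq K] (s : Finset K)
    (hs : (-1 : K) ∉ s) :
    ∑ a ∈ s, (1 - a) * ∏ b ∈ s.erase a, ((1 - a * b) / (b - a)) = 1 - ∏ a ∈ s, a := by
  set P : Polynomial K := ∏ b ∈ s, (Polynomial.C (-b) * Polynomial.X + Polynomial.C 1) with hP
  have hdeg : P.natDegree ≤ s.card := by
    refine (Polynomial.natDegree_prod_le _ _).trans ?_
    refine (Finset.sum_le_sum (g := fun _ => 1) fun b _ => Polynomial.natDegree_linear_le).trans ?_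
    simp
  have hcoeff : P.coeff s.card = ∏ b ∈ s, (-b) := by
    have := Polynomial.coeff_prod_of_natDegree_le (s := s)
      (fun b : K => Polynomial.C (-b) * Polynomial.X + Polynomial.C 1) 1
      (fun b _ => Polynomial.natDegree_linear_le)
    simpa [hP, Polynomial.coeff_one] using this
  have hcard : (insert (-1) s).card = s.card + 1 := Finset.card_insert_of_notMem hs
  have key := Lagrange.coeff_eq_sum (s := insert (-1) s) (v := (id : K → K))
    Function.injective_id.injOn (P := P) (by
      rw [hcard]
      exact lt_of_le_of_lt Polynomial.degree_le_natDegree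
        (by exact_mod_cast Nat.lt_succ_of_le hdeg))
  have heval : ∀ a, P.eval a = ∏ b ∈ s, (1 - a * b) := by
    intro a
    rw [hP, Polynomial.eval_prod]
    refine Finset.prod_congr rfl fun b _ => ?_
    simp; ring
  rw [hcard, Nat.add_sub_cancel, hcoeff, Finset.sum_insert hs, Finset.erase_insert hs] at key
  simp only [heval, id] at key
  have h1 : (∏ b ∈ s, (1 - (-1) * b)) / ∏ b ∈ s, (-1 - b) = (-1) ^ s.card := by
    rw [← Finset.prod_div_distrib, ← Finset.prod_const]
    refine Finset.prod_congr rfl fun b hb => ?_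
    have : -1 - b ≠ 0 := fun h => hs (by rwa [sub_eq_zero.mp h])
    rw [div_eq_iff this]; ring
  have h2 : ∀ a ∈ s, (∏ b ∈ s, (1 - a * b)) / ∏ b ∈ (insert (-1) s).erase a, (a - b) =
      -((-1) ^ s.card * ((1 - a) * ∏ b ∈ s.erase a, ((1 - a * b) / (b - a)))) := by
    intro a ha
    have hne : -1 ≠ a := fun h => hs (h ▸ ha)
    have hne' : a + 1 ≠ 0 := fun h => hne (eq_neg_of_add_eq_zero_left h).symm
    rw [Finset.erase_insert_of_ne hne, Finset.prod_insert (fun h => hs (Finset.mem_of_mem_erase h)),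
      ← Finset.mul_prod_erase s _ ha, mul_div_mul_comm, ← Finset.prod_div_distrib]
    have h3 : ∏ b ∈ s.erase a, ((1 - a * b) / (a - b)) =
        (-1) ^ (s.erase a).card * ∏ b ∈ s.erase a, ((1 - a * b) / (b - a)) := by
      rw [← Finset.prod_const, ← Finset.prod_mul_distrib]
      refine Finset.prod_congr rfl fun b _ => ?_
      rw [← neg_sub b a, div_neg]; ring
    have h4 : (1 - a * a) / (a - -1) = 1 - a := by
      rw [sub_neg_eq_add, div_eq_iff hne']; ring
    rw [h3, h4, ← Finset.card_erase_add_one ha, pow_succ]; ring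
  rw [h1, Finset.sum_congr rfl h2, Finset.sum_neg_distrib, ← Finset.mul_sum,
    Finset.prod_neg] at key
  have h5 : ((-1 : K) ^ s.card) * (-1) ^ s.card = 1 := by
    rw [← mul_pow]; simp
  linear_combination ((-1 : K) ^ s.card) * key +
    (1 - ∏ a ∈ s, a - ∑ a ∈ s, (1 - a) * ∏ b ∈ s.erase a, ((1 - a * b) / (b - a))) * h5

theorem det_vandermonde_succAbove {A : Type*} [CommRing A] {n : ℕ} (y : Fin (n + 1) → A)
    (i : Fin (n + 1)) :
    (Matrix.vandermonde y).det = (-1) ^ ((i : ℕ) + n) * (∏ j, (y i - y (i.succAbove j))) *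
      (Matrix.vandermonde (y ∘ i.succAbove)).det := by
  have h := Matrix.det_permute i.cycleRange.symm (Matrix.vandermonde y)
  have h2 : (Matrix.vandermonde y).submatrix i.cycleRange.symm id =
      Matrix.vandermonde (Fin.cons (y i) (y ∘ i.succAbove)) := by
    ext a b
    refine Fin.cases ?_ (fun a => ?_) a <;> simp [Matrix.vandermonde_apply]
  rw [h2, Equiv.Perm.sign_symm, Fin.sign_cycleRange, Matrix.det_vandermonde,
    Fin.prod_univ_succ] at h
  simp only [Fin.cons_zero, Fin.prod_Ioi_zero, Fin.cons_succ, Fin.prod_Ioi_succ] at h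
  rw [← Matrix.det_vandermonde] at h
  have h3 : ∏ j : Fin n, ((y ∘ i.succAbove) j - y i) =
      (-1) ^ n * ∏ j, (y i - y (i.succAbove j)) := by
    rw [← Fin.prod_const, ← Finset.prod_mul_distrib]
    exact Finset.prod_congr rfl fun j _ => by simp
  rw [h3] at h
  have h5 : ((-1 : A) ^ (i : ℕ)) * (-1) ^ (i : ℕ) = 1 := by
    rw [← mul_pow]; simp
  push_cast at h
  rw [pow_add]
  linear_combination (-(-1 : A) ^ (i : ℕ)) * h - (Matrix.vandermonde y).det * h5

/-- The product over pairs of a symmetric function, with the pairs through `i` split off. -/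
theorem prod_Ioi_succAbove {A : Type*} [CommMonoid A] {n : ℕ}
    (f : Fin (n + 1) → Fin (n + 1) → A) (hf : ∀ a b, f a b = f b a) (i : Fin (n + 1)) :
    ∏ a, ∏ b ∈ Finset.Ioi a, f a b = (∏ j, f i (i.succAbove j)) *
      ∏ a : Fin n, ∏ b ∈ Finset.Ioi a, f (i.succAbove a) (i.succAbove b) := by
  have hI : ∀ {m : ℕ} (a : Fin m) (g : Fin m → A),
      ∏ b ∈ Finset.Ioi a, g b = ∏ b, if a < b then g b else 1 := by
    intro m a g
    rw [← Finset.prod_filter]; congr 1; ext; simp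
  simp only [hI]
  rw [Fin.prod_univ_succAbove _ i, Fin.prod_univ_succAbove _ i]
  simp only [Fin.prod_univ_succAbove _ i, lt_irrefl, if_false, one_mul,
    (Fin.strictMono_succAbove i).lt_iff_lt, Finset.prod_mul_distrib]
  rw [← mul_assoc, ← Finset.prod_mul_distrib]
  congr 1
  refine Finset.prod_congr rfl fun j _ => ?_
  rcases lt_or_gt_of_ne (Fin.succAbove_ne i j) with h | h
  · simp [h, h.not_gt, hf]
  · simp [h, h.not_gt]

/-- The product `∏ (1 - x_i) ∏_{i < j} (1 - x_i x_j)`. -/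
def denomB {A : Type*} [CommRing A] {n : ℕ} (x : Fin n → A) : A :=
  (∏ i, (1 - x i)) * ∏ i, ∏ j ∈ Finset.Ioi i, (1 - x i * x j)

theorem denomB_succAbove {A : Type*} [CommRing A] {n : ℕ} (x : Fin (n + 1) → A)
    (i : Fin (n + 1)) :
    denomB x = (1 - x i) * (∏ j, (1 - x i * x (i.succAbove j))) * denomB (x ∘ i.succAbove) := by
  rw [denomB, denomB, prod_Ioi_succAbove (fun a b => 1 - x a * x b) (fun a b => by ring) i,
    Fin.prod_univ_succAbove _ i]
  simp only [Function.comp]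
  ring

/-- The determinant `det (x_i ^ j - x_i ^ (N + n - 1 - j))`, with `0 ≤ i, j < n`. For `N = n + p` it
is, up to sign, the numerator of an odd orthogonal character of rectangular shape. -/
def altB {A : Type*} [CommRing A] {n : ℕ} (N : ℕ) (x : Fin n → A) : A :=
  (Matrix.of fun i j : Fin n => x i ^ (j : ℕ) - x i ^ (N + (j.rev : ℕ))).det

/-- Inverts the variables in the positions belonging to `S`. -/
def invOn {K : Type*} [Field K] {n : ℕ} (S : Finset (Fin n)) (x : Fin n → K) (i : Fin n) : K :=
  if i ∈ S then (x i)⁻¹ else x i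

/-- The expansion of `altB` along the rows: a sum over sign changes of the Weyl group of type B. -/
theorem altB_eq_sum_vandermonde {K : Type*} [Field K] {n : ℕ} (N : ℕ) (x : Fin n → K)
    (hx : ∀ i, x i ≠ 0) :
    altB N x = ∑ S : Finset (Fin n), (∏ i ∈ S, -x i ^ (N + (n - 1))) *
      (Matrix.vandermonde (invOn S x)).det := by
  have h := (Matrix.detRowAlternating (n := Fin n) (R := K)).map_add_univ
    (fun i (j : Fin n) => -x i ^ (N + (j.rev : ℕ))) (fun i (j : Fin n) => x i ^ (j : ℕ))
  have h1 : altB N x = Matrix.detRowAlternating (n := Fin n) (R := K)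
      ((fun i (j : Fin n) => -x i ^ (N + (j.rev : ℕ))) + (fun i (j : Fin n) => x i ^ (j : ℕ))) := by
    rw [altB]
    congr 1
    ext i j
    simp [sub_eq_neg_add]
  rw [h1, h]
  refine Finset.sum_congr rfl fun S _ => ?_
  have h2 : (∏ i ∈ S, -x i ^ (N + (n - 1))) =
      ∏ i, (if i ∈ S then -x i ^ (N + (n - 1)) else 1) := by
    rw [Finset.prod_ite_mem, Finset.univ_inter]
  rw [h2, ← Matrix.det_mul_column]
  change Matrix.det _ = Matrix.det _
  congr 1
  ext i j
  by_cases hi : i ∈ S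
  · simp only [Finset.piecewise_eq_of_mem _ _ _ hi, Matrix.of_apply, hi, if_true, invOn,
      Matrix.vandermonde_apply]
    have : N + (n - 1) = N + (j.rev : ℕ) + j := by rw [Fin.val_rev]; omega
    rw [this, pow_add _ (N + (j.rev : ℕ)), inv_pow, neg_mul,
      mul_inv_cancel_right₀ (pow_ne_zero _ (hx i))]
  · simp [hi, invOn, Matrix.vandermonde_apply]

/-- For `N = 0` the first and the last column are negatives of each other. -/
theorem altB_zero {A : Type*} [CommRing A] [IsDomain A] {n : ℕ} (x : Fin (n + 1) → A) :
    altB 0 x = 0 := by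
  -- For `n = 0` the two columns coincide and vanish; the vector is still nonzero.
  refine Matrix.exists_mulVec_eq_zero_iff.mp
    ⟨fun j => if j = 0 ∨ j = Fin.last n then 1 else 0, fun h => ?_, ?_⟩
  · simpa using congrFun h 0
  · ext i
    simp only [Matrix.mulVec, dotProduct, Matrix.of_apply, mul_ite, mul_one, mul_zero,
      Pi.zero_apply]
    rw [← Finset.sum_filter]
    rcases Nat.eq_zero_or_pos n with rfl | hn
    · simp
    · have : Finset.univ.filter (fun j : Fin (n + 1) => j = 0 ∨ j = Fin.last n) =
          {0, Fin.last n} := by ext; simp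
      rw [this, Finset.sum_pair (by rw [ne_eq, Fin.ext_iff]; simp; omega)]
      simp

/-- Pairs of an index `i` and a set of other indices are regrouped by the set with `i` added. -/
theorem sum_insert_succAbove {M : Type*} [AddCommMonoid M] {n : ℕ}
    (F : Fin (n + 1) → Finset (Fin (n + 1)) → M) :
    ∑ i, ∑ S : Finset (Fin n), F i (insert i (S.map i.succAboveEmb)) =
      ∑ S : Finset (Fin (n + 1)), ∑ i ∈ S, F i S := by
  have h : ∀ i, ∑ S : Finset (Fin n), F i (insert i (S.map i.succAboveEmb)) =
      ∑ S : Finset (Fin (n + 1)) with i ∈ S, F i S := by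
    intro i
    refine Finset.sum_bij' (fun S _ => insert i (S.map i.succAboveEmb))
      (fun S _ => Finset.univ.filter fun j => i.succAbove j ∈ S) ?_ ?_ ?_ ?_ ?_
    · simp
    · simp
    · intro S _
      ext j
      simp [Fin.succAbove_ne]
    · intro S hS
      ext j
      refine Fin.succAboveCases i ?_ (fun j => ?_) j
      · simpa using (Finset.mem_filter.mp hS).2
      · simp [Fin.succAbove_ne]
    · simp
  simp only [h, Finset.sum_filter]
  rw [Finset.sum_comm]
  refine Finset.sum_congr rfl fun S _ => ?_
  rw [← Finset.sum_filter, Finset.filter_univ_mem]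

/-- The recursion satisfied by `altB`; the same recursion, without the factors `1 - x_i` and
`1 - x_i x_j`, is obeyed by the sum of all alternants with exponents below `N`. -/
theorem altB_succ {K : Type*} [Field K] {n : ℕ} (N : ℕ) (x : Fin (n + 1) → K)
    (hinj : Function.Injective x) (h0 : ∀ i, x i ≠ 0) (h1 : ∀ i, x i ≠ -1) :
    altB (N + 1) x = altB N x + ∑ i : Fin (n + 1), (-1) ^ ((i : ℕ) + n) * x i ^ N *
      ((1 - x i) * ∏ j, (1 - x i * x (i.succAbove j))) * altB N (x ∘ i.succAbove) := by
  classical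
  -- The common factor of all terms belonging to the set `S` of inverted variables.
  set c : Finset (Fin (n + 1)) → K := fun S =>
    (∏ i ∈ S, -x i ^ (N + n)) * (Matrix.vandermonde (invOn S x)).det with hc
  set q : Fin (n + 1) → Finset (Fin (n + 1)) → K := fun i S =>
    -(c S * ((1 - x i) * ∏ j ∈ S.erase i, ((1 - x i * x j) / (x j - x i)))) with hq
  have e1 : altB (N + 1) x = ∑ S, c S * ∏ i ∈ S, x i := by
    rw [altB_eq_sum_vandermonde _ _ h0]
    refine Finset.sum_congr rfl fun S _ => ?_
    rw [hc]
    simp only [Nat.add_sub_cancel]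
    rw [mul_right_comm, ← Finset.prod_mul_distrib]
    congr 1
    refine Finset.prod_congr rfl fun i _ => ?_
    ring
  have e2 : altB N x = ∑ S, c S := altB_eq_sum_vandermonde _ _ h0
  have e3 : ∀ i : Fin (n + 1), (-1) ^ ((i : ℕ) + n) * x i ^ N *
      ((1 - x i) * ∏ j, (1 - x i * x (i.succAbove j))) * altB N (x ∘ i.succAbove) =
      ∑ S : Finset (Fin n), q i (insert i (S.map i.succAboveEmb)) := by
    intro i
    rw [altB_eq_sum_vandermonde N (x ∘ i.succAbove) (fun j => h0 _), Finset.mul_sum]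
    refine Finset.sum_congr rfl fun S _ => ?_
    have hi : i ∉ S.map i.succAboveEmb := by simp [Fin.succAbove_ne]
    have hinv : invOn (insert i (S.map i.succAboveEmb)) x ∘ i.succAbove =
        invOn S (x ∘ i.succAbove) := by
      ext j; simp [invOn, Fin.succAbove_ne]
    have hinvi : invOn (insert i (S.map i.succAboveEmb)) x i = (x i)⁻¹ := by simp [invOn]
    simp only [hq, hc]
    rw [det_vandermonde_succAbove _ i, hinv, hinvi, Finset.prod_insert hi, Finset.erase_insert hi,
      Finset.prod_map, Finset.prod_map]
    simp only [Fin.coe_succAboveEmb, Function.comp]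
    -- Each factor `1 - x_i x_j` cancels a factor of the Vandermonde quotient.
    have key : (∏ j, (1 - x i * x (i.succAbove j))) * (∏ j ∈ S, x (i.succAbove j) ^ (N + (n - 1))) =
        x i ^ n * (∏ j ∈ S, x (i.succAbove j) ^ (N + n)) *
        (∏ j, ((x i)⁻¹ - invOn (insert i (S.map i.succAboveEmb)) x (i.succAbove j))) *
        ∏ j ∈ S, ((1 - x i * x (i.succAbove j)) / (x (i.succAbove j) - x i)) := by
      have hpow : x i ^ n = ∏ _j : Fin n, x i := by simp
      have hS : ∀ g : Fin n → K, ∏ j ∈ S, g j = ∏ j, if j ∈ S then g j else 1 := fun g => by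
        rw [Finset.prod_ite_mem, Finset.univ_inter]
      rw [hpow, hS, hS, hS]
      simp only [← Finset.prod_mul_distrib]
      refine Finset.prod_congr rfl fun j _ => ?_
      have hxi := h0 i
      have hxj := h0 (i.succAbove j)
      have hne : x (i.succAbove j) - x i ≠ 0 :=
        sub_ne_zero.mpr fun h => Fin.succAbove_ne i j (hinj h)
      by_cases hj : j ∈ S
      · have hn : N + n = N + (n - 1) + 1 := by have := j.pos; omega
        have : invOn (insert i (S.map i.succAboveEmb)) x (i.succAbove j) =
            (x (i.succAbove j))⁻¹ := by simp [invOn, hj]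
        simp only [hj, if_true, this, hn, pow_succ]
        field_simp
      · have : invOn (insert i (S.map i.succAboveEmb)) x (i.succAbove j) =
            x (i.succAbove j) := by simp [invOn, hj, Fin.succAbove_ne]
        simp only [hj, if_false, this]
        field_simp
    rw [Finset.prod_neg, Finset.prod_neg, pow_add (x i)]
    linear_combination ((-1) ^ ((i : ℕ) + n) * x i ^ N * (1 - x i) * (-1) ^ S.card *
      (Matrix.vandermonde (invOn S (x ∘ i.succAbove))).det) * key
  rw [e1, e2, Finset.sum_congr rfl fun i _ => e3 i, sum_insert_succAbove, ← Finset.sum_add_distrib]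
  refine Finset.sum_congr rfl fun S _ => ?_
  have hL := sum_one_sub_mul_prod_div (S.image x) (by simpa using fun i _ => h1 i)
  rw [Finset.sum_image hinj.injOn, Finset.prod_image hinj.injOn] at hL
  have hL' : ∑ i ∈ S, q i S = -(c S * (1 - ∏ i ∈ S, x i)) := by
    rw [← hL, Finset.mul_sum, ← Finset.sum_neg_distrib]
    refine Finset.sum_congr rfl fun i _ => ?_
    simp only [hq]
    rw [← Finset.image_erase hinj, Finset.prod_image hinj.injOn]
  rw [hL']; ring

/-- The sum of all alternants `det (x_i ^ k_j)` with `0 ≤ k_0 < ⋯ < k_{n-1} < N`. -/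
def altSum {A : Type*} [CommRing A] {n : ℕ} (N : ℕ) (x : Fin n → A) : A :=
  ∑ k ∈ (Fintype.piFinset fun _ : Fin n => Finset.range N) with StrictMono k,
    (Matrix.of fun i j => x i ^ k j).det

theorem strictMono_snoc {n N : ℕ} {k : Fin n → ℕ} (hk : StrictMono k) (hN : ∀ j, k j < N) :
    StrictMono (Fin.snoc k N : Fin (n + 1) → ℕ) := by
  intro a b
  refine Fin.lastCases ?_ (fun b => ?_) b
  · refine Fin.lastCases ?_ (fun a => ?_) a
    · simp
    · simp [hN]
  · refine Fin.lastCases ?_ (fun a => ?_) a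
    · intro h
      exact absurd h (Fin.castSucc_lt_last b).not_gt
    · simpa using fun h => hk h

/-- The sum over all exponents is split according to whether the largest one equals `N`. -/
theorem altSum_succ {A : Type*} [CommRing A] {n : ℕ} (N : ℕ) (x : Fin (n + 1) → A) :
    altSum (N + 1) x = altSum N x + ∑ i : Fin (n + 1), (-1) ^ ((i : ℕ) + n) * x i ^ N *
      altSum N (x ∘ i.succAbove) := by
  have hlast : ∀ k : Fin (n + 1) → ℕ, StrictMono k → ∀ j, k j ≤ k (Fin.last n) :=
    fun k hk j => hk.monotone (Fin.le_last j)
  rw [altSum, ← Finset.sum_filter_add_sum_filter_not _ (fun k => k (Fin.last n) = N), add_comm]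
  congr 1
  · rw [altSum]
    refine Finset.sum_congr ?_ fun _ _ => rfl
    ext k
    simp only [Finset.mem_filter, Fintype.mem_piFinset, Finset.mem_range]
    constructor
    · rintro ⟨⟨h1, h2⟩, h3⟩
      refine ⟨fun j => ?_, h2⟩
      have := hlast k h2 j
      have := h1 (Fin.last n)
      omega
    · rintro ⟨h1, h2⟩
      exact ⟨⟨fun j => (h1 j).trans (Nat.lt_succ_self N), h2⟩, (h1 _).ne⟩
  · have h : ∑ k ∈ (Fintype.piFinset fun _ : Fin n => Finset.range N) with StrictMono k,
        (Matrix.of fun i j => x i ^ (Fin.snoc k N : Fin (n + 1) → ℕ) j).det =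
        ∑ i : Fin (n + 1), (-1) ^ ((i : ℕ) + n) * x i ^ N * altSum N (x ∘ i.succAbove) := by
      simp only [altSum, Finset.mul_sum]
      rw [Finset.sum_comm]
      refine Finset.sum_congr rfl fun k _ => ?_
      rw [Matrix.det_succ_column _ (Fin.last n)]
      refine Finset.sum_congr rfl fun i _ => ?_
      simp only [Matrix.of_apply, Fin.snoc_last, Fin.val_last, Fin.succAbove_last]
      congr 2
      ext a b
      simp
    rw [← h]
    refine Finset.sum_bij' (fun k _ => Fin.init k) (fun k _ => Fin.snoc k N) ?_ ?_ ?_ ?_ ?_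
    · intro k hk
      simp only [Finset.mem_filter, Fintype.mem_piFinset, Finset.mem_range] at hk ⊢
      refine ⟨fun j => ?_, fun a b hab => hk.1.2 (by simpa using hab)⟩
      rw [← hk.2]
      exact hk.1.2 (Fin.castSucc_lt_last j)
    · intro k hk
      simp only [Finset.mem_filter, Fintype.mem_piFinset, Finset.mem_range] at hk ⊢
      refine ⟨⟨fun j => ?_, strictMono_snoc hk.2 hk.1⟩, by simp⟩
      refine Fin.lastCases (by simp) (fun j => ?_) j
      simpa using (hk.1 j).trans (Nat.lt_succ_self N)
    · intro k hk
      simp only [Finset.mem_filter] at hk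
      rw [← hk.2, Fin.snoc_init_self]
    · intro k _
      simp
    · intro k hk
      simp only [Finset.mem_filter] at hk
      rw [← hk.2, Fin.snoc_init_self]

/-- The bounded sum of alternants as a single determinant. -/
theorem altSum_mul_denomB {K : Type*} [Field K] {n : ℕ} (N : ℕ) (x : Fin n → K)
    (hinj : Function.Injective x) (h0 : ∀ i, x i ≠ 0) (h1 : ∀ i, x i ≠ -1) :
    altSum N x * denomB x = altB N x := by
  induction N generalizing n with
  | zero =>
    cases n with
    | zero => simp [altSum, denomB, altB, Subsingleton.strictMono]
    | succ n =>
      rw [altB_zero, altSum, Finset.sum_eq_zero, zero_mul]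
      simp
  | succ N ih =>
    cases n with
    | zero => simp [altSum, denomB, altB, Subsingleton.strictMono]
    | succ n =>
      rw [altSum_succ, altB_succ N x hinj h0 h1, add_mul, ih x hinj h0 h1, Finset.sum_mul]
      congr 1
      refine Finset.sum_congr rfl fun i _ => ?_
      rw [← ih (x ∘ i.succAbove) (hinj.comp Fin.succAbove_right_injective) (fun _ => h0 _)
        (fun _ => h1 _), denomB_succAbove x i]
      ring

/-! ### Schur polynomials as quotients of alternants -/

/-- Elimination of the last variable from an alternant. -/
theorem det_pow_succ {A : Type*} [CommRing A] {n : ℕ} (x : Fin (n + 1) → A)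
    {l : Fin (n + 1) → ℕ} (hl : StrictMono l) :
    (Matrix.of fun i j => x i ^ l j).det =
      (∏ i : Fin n, (x (Fin.last n) - x i.castSucc)) *
        ∑ k ∈ Fintype.piFinset fun j : Fin n => Finset.Ico (l j.castSucc) (l j.succ),
          x (Fin.last n) ^ (l 0 + ∑ j : Fin n, (l j.succ - 1 - k j)) *
            (Matrix.of fun i j => x i.castSucc ^ k j).det := by
  set y := x (Fin.last n)
  -- Subtracting from each column a multiple of the preceding one clears the last row except for its
  -- first entry; `B` is the resulting matrix.
  set F : Fin (n + 1) → Fin n → A := fun i j =>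
    ∑ k ∈ Finset.Ico (l j.castSucc) (l j.succ), x i ^ k * y ^ (l j.succ - 1 - k)
  set B : Matrix (Fin (n + 1)) (Fin (n + 1)) A :=
    Matrix.of fun i => Fin.cons (x i ^ l 0) fun j => (x i - y) * F i j
  have hB : (Matrix.of fun i j => x i ^ l j).det = B.det := by
    refine Matrix.det_eq_of_forall_col_eq_smul_add_pred
      (fun j => y ^ (l j.succ - l j.castSucc)) ?_ ?_
    · intro i; simp [B]
    · intro i j
      have := (Commute.all (x i) y).mul_geom_sum₂_Ico (hl (Fin.castSucc_lt_succ (i := j))).le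
      simp only [B, Matrix.of_apply, Fin.cons_succ, F]
      rw [this]; ring
  have hdet : B.det = (-1) ^ n * y ^ l 0 *
      (Matrix.of fun i j : Fin n => (x i.castSucc - y) * F i.castSucc j).det := by
    rw [Matrix.det_succ_row _ (Fin.last n), Fin.sum_univ_succ, Finset.sum_eq_zero, add_zero]
    · simp only [Fin.val_last, Fin.val_zero, add_zero]
      congr 2
      ext i j
      simp [B]
    · intro j _
      simp [B, y]
  have hrow : (Matrix.of fun i j : Fin n => (x i.castSucc - y) * F i.castSucc j).det =
      (∏ i : Fin n, (x i.castSucc - y)) * (Matrix.of fun i j : Fin n => F i.castSucc j).det :=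
    Matrix.det_mul_column (fun i : Fin n => x i.castSucc - y)
      (Matrix.of fun i j : Fin n => F i.castSucc j)
  have hsum : (Matrix.of fun i j : Fin n => F i.castSucc j).det =
      ∑ k ∈ Fintype.piFinset fun j : Fin n => Finset.Ico (l j.castSucc) (l j.succ),
        y ^ (∑ j : Fin n, (l j.succ - 1 - k j)) *
          (Matrix.of fun i j => x i.castSucc ^ k j).det := by
    have := (Matrix.detRowAlternating (n := Fin n) (R := A)).toMultilinearMap.map_sum_finset
      (fun (j : Fin n) (k : ℕ) (i : Fin n) => x i.castSucc ^ k * y ^ (l j.succ - 1 - k))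
      (fun j => Finset.Ico (l j.castSucc) (l j.succ))
    rw [← Matrix.det_transpose]
    refine Eq.trans ?_ (this.trans ?_)
    · change Matrix.det _ = Matrix.det _
      congr 1
      ext j i
      simp [F]
    · refine Finset.sum_congr rfl fun k _ => ?_
      rw [← Finset.prod_pow_eq_pow_sum, ← Matrix.det_mul_row, ← Matrix.det_transpose]
      change Matrix.det _ = Matrix.det _
      congr 1
      ext j i
      simp [mul_comm]
  have hneg : (∏ i : Fin n, (y - x i.castSucc)) = (-1) ^ n * ∏ i : Fin n, (x i.castSucc - y) := by
    rw [← Fin.prod_const, ← Finset.prod_mul_distrib]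
    exact Finset.prod_congr rfl fun j _ => by ring
  rw [hB, hdet, hrow, hsum, hneg]
  simp only [pow_add, mul_assoc, ← Finset.mul_sum]
  ring

theorem det_vandermonde_castSucc {A : Type*} [CommRing A] {n : ℕ} (x : Fin (n + 1) → A) :
    (Matrix.vandermonde x).det = (∏ i : Fin n, (x (Fin.last n) - x i.castSucc)) *
      (Matrix.vandermonde (x ∘ Fin.castSucc)).det := by
  have h := det_vandermonde_succAbove x (Fin.last n)
  rw [h]
  simp only [Fin.val_last, Fin.succAbove_last]
  rw [← two_mul, pow_mul]
  simp [Function.comp_def]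

/-- The diagram with row lengths `g 0, …, g (n - 1)`. To have a total function, the largest diagram
whose `i`-th row has at most `g i` boxes is taken; for antitone `g` the bounds are attained. -/
def rowDiagram {n : ℕ} (g : Fin n → ℕ) : YoungDiagram where
  cells := (Finset.range n ×ˢ Finset.range (Finset.univ.sup g)).filter
    fun c => ∀ i : Fin n, (i : ℕ) ≤ c.1 → c.2 < g i
  isLowerSet := by
    rintro ⟨i, j⟩ ⟨i', j'⟩ ⟨hi, hj⟩ h
    simp only [Finset.coe_filter, Finset.mem_product, Finset.mem_range, Set.mem_ofPred_eq] at *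
    exact ⟨⟨by omega, by omega⟩, fun a ha => hj.trans_lt (h.2 a (ha.trans hi))⟩

theorem mem_rowDiagram {n : ℕ} {g : Fin n → ℕ} {i j : ℕ} :
    (i, j) ∈ rowDiagram g ↔ i < n ∧ ∀ a : Fin n, (a : ℕ) ≤ i → j < g a := by
  rw [← YoungDiagram.mem_cells]
  simp only [rowDiagram, Finset.mem_filter, Finset.mem_product, Finset.mem_range]
  constructor
  · rintro ⟨⟨h1, _⟩, h3⟩
    exact ⟨h1, h3⟩
  · rintro ⟨h1, h3⟩
    exact ⟨⟨h1, (h3 ⟨i, h1⟩ le_rfl).trans_le (Finset.le_sup (Finset.mem_univ _))⟩, h3⟩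

theorem mem_rowDiagram_of_antitone {n : ℕ} {g : Fin n → ℕ} (hg : Antitone g) {i j : ℕ} :
    (i, j) ∈ rowDiagram g ↔ ∃ h : i < n, j < g ⟨i, h⟩ := by
  rw [mem_rowDiagram]
  constructor
  · rintro ⟨h, h'⟩
    exact ⟨h, h' _ le_rfl⟩
  · rintro ⟨h, h'⟩
    exact ⟨h, fun a ha => h'.trans_le (hg ha)⟩

theorem rowLen_rowDiagram {n : ℕ} {g : Fin n → ℕ} (hg : Antitone g) (i : Fin n) :
    (rowDiagram g).rowLen i = g i := by
  refine Nat.le_antisymm (le_of_forall_lt fun j hj => ?_) (le_of_forall_lt fun j hj => ?_)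
  · rw [← YoungDiagram.mem_iff_lt_rowLen, mem_rowDiagram_of_antitone hg] at hj
    exact hj.2
  · rw [← YoungDiagram.mem_iff_lt_rowLen, mem_rowDiagram_of_antitone hg]
    exact ⟨i.2, hj⟩

theorem colLen_rowDiagram_le {n : ℕ} (g : Fin n → ℕ) : (rowDiagram g).colLen 0 ≤ n := by
  refine le_of_forall_lt fun j hj => ?_
  rw [← YoungDiagram.mem_iff_lt_colLen, mem_rowDiagram] at hj
  exact hj.1

theorem rowLen_eq_zero_of_colLen_le {μ : YoungDiagram} {i : ℕ} (h : μ.colLen 0 ≤ i) :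
    μ.rowLen i = 0 := by
  by_contra h0
  have := YoungDiagram.mem_iff_lt_colLen.mp
    (YoungDiagram.mem_iff_lt_rowLen.mpr (Nat.pos_of_ne_zero h0))
  omega

theorem eq_rowDiagram {n : ℕ} {μ : YoungDiagram} (h : μ.colLen 0 ≤ n) :
    μ = rowDiagram fun i : Fin n => μ.rowLen i := by
  ext ⟨i, j⟩
  rw [YoungDiagram.mem_cells, YoungDiagram.mem_cells,
    mem_rowDiagram_of_antitone fun a b hab => μ.rowLen_anti _ _ hab,
    YoungDiagram.mem_iff_lt_rowLen]
  constructor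
  · intro hj
    refine ⟨?_, hj⟩
    by_contra hi
    rw [rowLen_eq_zero_of_colLen_le (by omega)] at hj
    omega
  · rintro ⟨_, hj⟩
    exact hj

theorem card_eq_sum_rowLen {n : ℕ} {μ : YoungDiagram} (h : μ.colLen 0 ≤ n) :
    μ.card = ∑ i : Fin n, μ.rowLen i := by
  rw [YoungDiagram.card, Finset.card_eq_sum_card_fiberwise (f := Prod.fst)
    (t := Finset.range n), Finset.sum_range]
  · refine Finset.sum_congr rfl fun i _ => ?_
    rw [YoungDiagram.rowLen_eq_card]; rfl
  · rintro ⟨i, j⟩ hc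
    have := YoungDiagram.mem_iff_lt_colLen.mp (μ.up_left_mem le_rfl (Nat.zero_le j) hc)
    simp; omega

/-- The value of the Schur polynomial of shape `μ` at the point `x`. -/
noncomputable def schurEval {A : Type*} [CommRing A] {n : ℕ} (x : Fin n → A) (μ : YoungDiagram) :
    A :=
  ∑ T : BoundedSSYT μ n, ∏ c : {c : ℕ × ℕ // c ∈ μ.cells}, x (T.entryFin c)

theorem map_schurEval {A B : Type*} [CommRing A] [CommRing B] (φ : A →+* B) {n : ℕ}
    (x : Fin n → A) (μ : YoungDiagram) : φ (schurEval x μ) = schurEval (φ ∘ x) μ := by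
  simp [schurEval, map_sum, map_prod]

theorem SemistandardYoungTableau.le_entry {μ : YoungDiagram} (T : SemistandardYoungTableau μ)
    {i j : ℕ} (h : (i, j) ∈ μ) : i ≤ T i j := by
  induction i with
  | zero => exact Nat.zero_le _
  | succ i ih =>
    exact (ih (μ.up_left_mem (Nat.le_succ i) le_rfl h)).trans_lt
      (T.col_strict (Nat.lt_succ_self i) h)

theorem schurEval_eq_zero {A : Type*} [CommRing A] {n : ℕ} (x : Fin n → A) {μ : YoungDiagram}
    (h : n < μ.colLen 0) : schurEval x μ = 0 := by
  have : IsEmpty (BoundedSSYT μ n) := ⟨fun T => by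
    have hm := YoungDiagram.mem_iff_lt_colLen.mpr h
    exact (T.1.le_entry hm).not_gt (T.2 _ _ hm)⟩
  rw [schurEval, Finset.univ_eq_empty, Finset.sum_empty]

theorem BoundedSSYT.prod_entryFin {A : Type*} [CommRing A] {n : ℕ} {μ : YoungDiagram}
    (x : Fin n → A) (T : BoundedSSYT μ n) :
    ∏ c : {c : ℕ × ℕ // c ∈ μ.cells}, x (T.entryFin c) =
      ∏ c ∈ μ.cells, if h : T.1 c.1 c.2 < n then x ⟨T.1 c.1 c.2, h⟩ else 1 := by
  rw [← Finset.prod_coe_sort μ.cells]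
  refine Finset.prod_congr rfl fun c _ => ?_
  rw [dif_pos (T.2 _ _ c.2)]
  rfl

/-- The cells of a tableau with entries in `{0, …, n}` that do not contain the entry `n`. -/
def BoundedSSYT.restrictShape {n : ℕ} {μ : YoungDiagram} (T : BoundedSSYT μ (n + 1)) :
    YoungDiagram where
  cells := μ.cells.filter fun c => T.1 c.1 c.2 < n
  isLowerSet := by
    rintro ⟨i, j⟩ ⟨i', j'⟩ ⟨hi, hj⟩ h
    simp only [Finset.coe_filter, YoungDiagram.mem_cells, Set.mem_ofPred_eq] at *
    have h1 : (i', j) ∈ μ := μ.up_left_mem hi le_rfl h.1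
    exact ⟨μ.up_left_mem le_rfl hj h1, (T.1.row_weak_of_le hj h1).trans_lt
      ((T.1.col_weak hi h.1).trans_lt h.2)⟩

theorem BoundedSSYT.mem_restrictShape {n : ℕ} {μ : YoungDiagram} {T : BoundedSSYT μ (n + 1)}
    {i j : ℕ} : (i, j) ∈ T.restrictShape ↔ (i, j) ∈ μ ∧ T.1 i j < n := by
  rw [← YoungDiagram.mem_cells]
  simp [restrictShape]

theorem BoundedSSYT.restrictShape_eq {n : ℕ} {μ : YoungDiagram} (T : BoundedSSYT μ (n + 1)) :
    T.restrictShape = rowDiagram fun i : Fin n => T.restrictShape.rowLen i := by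
  refine eq_rowDiagram (le_of_forall_lt fun i hi => ?_)
  rw [← YoungDiagram.mem_iff_lt_colLen, mem_restrictShape] at hi
  exact (T.1.le_entry hi.1).trans_lt hi.2

/-- The shapes obtained from `μ` by removing a horizontal strip, as sequences of `n` row lengths. -/
def interlacing (n : ℕ) (μ : YoungDiagram) : Finset (Fin n → ℕ) :=
  Fintype.piFinset fun i => Finset.Icc (μ.rowLen (i + 1)) (μ.rowLen i)

theorem antitone_of_mem_interlacing {n : ℕ} {μ : YoungDiagram} {g : Fin n → ℕ}
    (hg : g ∈ interlacing n μ) : Antitone g := by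
  simp only [interlacing, Fintype.mem_piFinset, Finset.mem_Icc] at hg
  intro a b hab
  rcases hab.eq_or_lt with rfl | h
  · exact le_rfl
  · exact (hg b).2.trans ((μ.rowLen_anti _ _ h).trans (hg a).1)

theorem BoundedSSYT.rowLen_restrictShape_mem {n : ℕ} {μ : YoungDiagram}
    (T : BoundedSSYT μ (n + 1)) :
    (fun i : Fin n => T.restrictShape.rowLen i) ∈ interlacing n μ := by
  simp only [interlacing, Fintype.mem_piFinset, Finset.mem_Icc]
  refine fun i => ⟨le_of_forall_lt fun j hj => ?_, le_of_forall_lt fun j hj => ?_⟩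
  · rw [← YoungDiagram.mem_iff_lt_rowLen] at hj ⊢
    rw [mem_restrictShape]
    have h1 := T.1.col_strict (Nat.lt_add_one (i : ℕ)) hj
    have h2 := T.2 _ _ hj
    exact ⟨μ.up_left_mem (Nat.le_succ _) le_rfl hj, by omega⟩
  · rw [← YoungDiagram.mem_iff_lt_rowLen] at hj ⊢
    exact (mem_restrictShape.mp hj).1

/-- Deletes the cells with entry `n`. -/
def BoundedSSYT.restrict {n : ℕ} {μ ν : YoungDiagram} (T : BoundedSSYT μ (n + 1))
    (h : T.restrictShape = ν) : BoundedSSYT ν n :=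
  ⟨{ entry := fun i j => if (i, j) ∈ ν then T.1 i j else 0
     row_weak' := by
      intro i j1 j2 hj hc
      have hc' := hc
      rw [← h, mem_restrictShape] at hc'
      rw [if_pos hc, if_pos (ν.up_left_mem le_rfl hj.le hc)]
      exact T.1.row_weak hj hc'.1
     col_strict' := by
      intro i1 i2 j hi hc
      have hc' := hc
      rw [← h, mem_restrictShape] at hc'
      rw [if_pos hc, if_pos (ν.up_left_mem hi.le le_rfl hc)]
      exact T.1.col_strict hi hc'.1
     zeros' := fun hc => if_neg hc },
    fun i j hc => by
      change (if (i, j) ∈ ν then T.1 i j else 0) < n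
      rw [if_pos hc]
      rw [← h, mem_restrictShape] at hc
      exact hc.2⟩

theorem BoundedSSYT.restrict_apply {n : ℕ} {μ ν : YoungDiagram} (T : BoundedSSYT μ (n + 1))
    (h : T.restrictShape = ν) (i j : ℕ) :
    (T.restrict h).1 i j = if (i, j) ∈ ν then T.1 i j else 0 :=
  rfl

/-- Fills the cells of `μ` outside the shape `rowDiagram g` with the entry `n`. -/
def BoundedSSYT.extend {n : ℕ} {μ : YoungDiagram} (hμ : μ.colLen 0 ≤ n + 1) {g : Fin n → ℕ}
    (hg : g ∈ interlacing n μ) (T : BoundedSSYT (rowDiagram g) n) : BoundedSSYT μ (n + 1) :=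
  ⟨{ entry := fun i j => if (i, j) ∈ rowDiagram g then T.1 i j else if (i, j) ∈ μ then n else 0
     row_weak' := by
      intro i j1 j2 hj hc
      by_cases h2 : (i, j2) ∈ rowDiagram g
      · rw [if_pos h2, if_pos ((rowDiagram g).up_left_mem le_rfl hj.le h2)]
        exact T.1.row_weak hj h2
      · rw [if_neg h2, if_pos hc]
        split_ifs with h3
        · exact (T.2 _ _ h3).le
        · exact le_rfl
        · exact Nat.zero_le _
     col_strict' := by
      intro i1 i2 j hi hc
      have h1 : (i1, j) ∈ rowDiagram g := by
        have hn : i1 < n := by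
          have := YoungDiagram.mem_iff_lt_colLen.mp (μ.up_left_mem le_rfl (Nat.zero_le j) hc)
          omega
        rw [mem_rowDiagram_of_antitone (antitone_of_mem_interlacing hg)]
        simp only [interlacing, Fintype.mem_piFinset, Finset.mem_Icc] at hg
        exact ⟨hn, (YoungDiagram.mem_iff_lt_rowLen.mp hc).trans_le
          ((μ.rowLen_anti _ _ hi).trans (hg ⟨i1, hn⟩).1)⟩
      rw [if_pos h1]
      by_cases h2 : (i2, j) ∈ rowDiagram g
      · rw [if_pos h2]
        exact T.1.col_strict hi h2
      · rw [if_neg h2, if_pos hc]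
        exact T.2 _ _ h1
     zeros' := by
      intro i j hc
      have : (i, j) ∉ rowDiagram g := by
        rw [mem_rowDiagram_of_antitone (antitone_of_mem_interlacing hg)]
        rintro ⟨hn, h⟩
        simp only [interlacing, Fintype.mem_piFinset, Finset.mem_Icc] at hg
        exact hc (YoungDiagram.mem_iff_lt_rowLen.mpr (h.trans_le (hg _).2))
      rw [if_neg this, if_neg hc] },
    fun i j hc => by
      change (if (i, j) ∈ rowDiagram g then T.1 i j else if (i, j) ∈ μ then n else 0) < n + 1
      split_ifs with h
      · exact (T.2 _ _ h).trans (Nat.lt_succ_self n)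
      · exact Nat.lt_succ_self n⟩

theorem BoundedSSYT.extend_apply {n : ℕ} {μ : YoungDiagram} (hμ : μ.colLen 0 ≤ n + 1)
    {g : Fin n → ℕ} (hg : g ∈ interlacing n μ) (T : BoundedSSYT (rowDiagram g) n) (i j : ℕ) :
    (T.extend hμ hg).1 i j =
      if (i, j) ∈ rowDiagram g then T.1 i j else if (i, j) ∈ μ then n else 0 :=
  rfl

theorem rowDiagram_le_of_mem_interlacing {n : ℕ} {μ : YoungDiagram} {g : Fin n → ℕ}
    (hg : g ∈ interlacing n μ) : rowDiagram g ≤ μ := by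
  rintro ⟨i, j⟩ h
  rw [mem_rowDiagram_of_antitone (antitone_of_mem_interlacing hg)] at h
  simp only [interlacing, Fintype.mem_piFinset, Finset.mem_Icc] at hg
  obtain ⟨hn, h⟩ := h
  exact YoungDiagram.mem_iff_lt_rowLen.mpr (h.trans_le (hg _).2)

theorem BoundedSSYT.restrictShape_extend {n : ℕ} {μ : YoungDiagram} (hμ : μ.colLen 0 ≤ n + 1)
    {g : Fin n → ℕ} (hg : g ∈ interlacing n μ) (T : BoundedSSYT (rowDiagram g) n) :
    (T.extend hμ hg).restrictShape = rowDiagram g := by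
  ext ⟨i, j⟩
  rw [YoungDiagram.mem_cells, YoungDiagram.mem_cells, mem_restrictShape, extend_apply]
  by_cases h : (i, j) ∈ rowDiagram g
  · simp only [h, if_true, iff_true]
    exact ⟨rowDiagram_le_of_mem_interlacing hg h, T.2 _ _ h⟩
  · simp only [h, if_false, iff_false]
    rintro ⟨h1, h2⟩
    simp [h1] at h2

/-- Removing the largest entry from all tableaux of shape `μ`. -/
theorem schurEval_succ {A : Type*} [CommRing A] {n : ℕ} (x : Fin (n + 1) → A) {μ : YoungDiagram}
    (hμ : μ.colLen 0 ≤ n + 1) :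
    schurEval x μ = ∑ g ∈ interlacing n μ,
      x (Fin.last n) ^ (μ.rowLen n + ∑ i : Fin n, (μ.rowLen i - g i)) *
        schurEval (x ∘ Fin.castSucc) (rowDiagram g) := by
  rw [schurEval, ← Finset.sum_fiberwise_of_maps_to
    (g := fun (T : BoundedSSYT μ (n + 1)) (i : Fin n) => T.restrictShape.rowLen i)
    (fun T _ => T.rowLen_restrictShape_mem)]
  refine Finset.sum_congr rfl fun g hg => ?_
  rw [schurEval, Finset.mul_sum]
  have hshape : ∀ T ∈ Finset.univ.filter fun T : BoundedSSYT μ (n + 1) =>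
      (fun i : Fin n => T.restrictShape.rowLen i) = g, T.restrictShape = rowDiagram g := by
    intro T hT
    rw [← (Finset.mem_filter.mp hT).2]
    exact T.restrictShape_eq
  refine Finset.sum_bij' (fun T hT => T.restrict (hshape T hT)) (fun T _ => T.extend hμ hg)
    ?_ ?_ ?_ ?_ ?_
  · simp
  · intro T _
    simp only [Finset.mem_filter, Finset.mem_univ, true_and]
    ext i
    rw [BoundedSSYT.restrictShape_extend, rowLen_rowDiagram (antitone_of_mem_interlacing hg)]
  · intro T hT
    apply Subtype.ext
    ext i j
    rw [BoundedSSYT.extend_apply, BoundedSSYT.restrict_apply]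
    split_ifs with h1 h2
    · rfl
    · rw [← hshape T hT, BoundedSSYT.mem_restrictShape] at h1
      have := T.2 _ _ h2
      by_contra hne
      exact h1 ⟨h2, by omega⟩
    · exact (T.1.zeros h2).symm
  · intro T _
    apply Subtype.ext
    ext i j
    rw [BoundedSSYT.restrict_apply, BoundedSSYT.extend_apply]
    split_ifs with h1
    · rfl
    · exact (T.1.zeros h1).symm
  · intro T hT
    have hs := hshape T hT
    have hle := rowDiagram_le_of_mem_interlacing hg
    have hcells : μ.cells.filter (fun c => c ∈ (rowDiagram g).cells) = (rowDiagram g).cells := by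
      rw [Finset.filter_mem_eq_inter, Finset.inter_eq_right]
      exact YoungDiagram.cells_subset_iff.mpr hle
    rw [BoundedSSYT.prod_entryFin, BoundedSSYT.prod_entryFin,
      ← Finset.prod_filter_mul_prod_filter_not μ.cells (fun c => c ∈ (rowDiagram g).cells),
      hcells, mul_comm]
    congr 1
    · have hconst : ∀ c ∈ μ.cells.filter (fun c => c ∉ (rowDiagram g).cells),
          (if h : T.1 c.1 c.2 < n + 1 then x ⟨T.1 c.1 c.2, h⟩ else 1) = x (Fin.last n) := by
        rintro ⟨i, j⟩ hc
        simp only [Finset.mem_filter, YoungDiagram.mem_cells] at hc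
        have h1 := T.2 _ _ hc.1
        rw [dif_pos h1]
        rw [← hs, BoundedSSYT.mem_restrictShape] at hc
        congr 1
        apply Fin.ext
        simp only [Fin.val_last]
        by_contra hne
        exact hc.2 ⟨hc.1, by omega⟩
      rw [Finset.prod_congr rfl hconst, Finset.prod_const]
      congr 1
      have h1 := Finset.card_filter_add_card_filter_not (s := μ.cells)
        (fun c => c ∈ (rowDiagram g).cells)
      rw [hcells] at h1
      have h2 := card_eq_sum_rowLen hμ
      have h3 := card_eq_sum_rowLen (colLen_rowDiagram_le g)
      simp only [rowLen_rowDiagram (antitone_of_mem_interlacing hg)] at h3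
      rw [Fin.sum_univ_castSucc] at h2
      simp only [Fin.val_castSucc, Fin.val_last] at h2
      have h4 : ∑ i : Fin n, (μ.rowLen i - g i) + ∑ i : Fin n, g i = ∑ i : Fin n, μ.rowLen i := by
        rw [← Finset.sum_add_distrib]
        refine Finset.sum_congr rfl fun i _ => ?_
        simp only [interlacing, Fintype.mem_piFinset, Finset.mem_Icc] at hg
        have := (hg i).2
        omega
      rw [YoungDiagram.card] at h2 h3
      omega
    · refine Finset.prod_congr rfl ?_
      rintro ⟨i, j⟩ hc
      have h1 := (T.restrict hs).2 _ _ hc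
      have h2 : (T.restrict hs).1 i j = T.1 i j := by
        rw [BoundedSSYT.restrict_apply]
        exact if_pos hc
      rw [h2] at h1
      simp only [h2]
      rw [dif_pos h1, dif_pos (h1.trans (Nat.lt_succ_self n))]
      rfl

/-- The Schur polynomial as a quotient of alternants. The exponents `μ_i + n - 1 - i` are listed in
increasing order. -/
theorem det_rowLen_eq {A : Type*} [CommRing A] {n : ℕ} (x : Fin n → A) {μ : YoungDiagram}
    (hμ : μ.colLen 0 ≤ n) :
    (Matrix.of fun i j : Fin n => x i ^ (μ.rowLen j.rev + j)).det =
      schurEval x μ * (Matrix.vandermonde x).det := by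
  induction n generalizing μ with
  | zero =>
    have hE : IsEmpty {c : ℕ × ℕ // c ∈ μ.cells} := by
      refine ⟨fun ⟨⟨i, j⟩, h⟩ => ?_⟩
      have := YoungDiagram.mem_iff_lt_colLen.mp (μ.up_left_mem le_rfl (Nat.zero_le j) h)
      omega
    have := (BoundedSSYT.entryFin_injective μ 0).subsingleton
    have T : BoundedSSYT μ 0 :=
      ⟨SemistandardYoungTableau.highestWeight μ, fun i j h => (hE.false ⟨(i, j), h⟩).elim⟩
    rw [schurEval, Fintype.sum_subsingleton _ T]
    simp
  | succ n ih =>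
    have hanti : ∀ a b : ℕ, a ≤ b → μ.rowLen b ≤ μ.rowLen a := μ.rowLen_anti
    rw [det_pow_succ x (l := fun j => μ.rowLen j.rev + j), schurEval_succ x hμ,
      det_vandermonde_castSucc, mul_left_comm, Finset.sum_mul]
    · congr 1
      have hrev : ∀ j : Fin n, (j.castSucc.rev : ℕ) = (j.rev : ℕ) + 1 := fun j => by
        simp only [Fin.val_rev, Fin.val_castSucc]; omega
      have hrev' : ∀ j : Fin n, (j.succ.rev : ℕ) = j.rev := fun j => by
        simp only [Fin.val_rev, Fin.val_succ]; omega
      refine Finset.sum_bij' (fun k _ i => k i.rev - (i.rev : ℕ)) (fun g _ j => g j.rev + j)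
        ?_ ?_ ?_ ?_ ?_
      · intro k hk
        simp only [interlacing, Fintype.mem_piFinset, Finset.mem_Icc, Finset.mem_Ico, hrev,
          hrev', Fin.val_castSucc, Fin.val_succ] at hk ⊢
        intro i
        have := hk i.rev
        rw [Fin.rev_rev] at this
        omega
      · intro g hg
        simp only [interlacing, Fintype.mem_piFinset, Finset.mem_Icc, Finset.mem_Ico, hrev,
          hrev', Fin.val_castSucc, Fin.val_succ] at hg ⊢
        intro j
        have := hg j.rev
        omega
      · intro k hk
        simp only [Fintype.mem_piFinset, Finset.mem_Ico, hrev, Fin.val_castSucc] at hk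
        ext j
        have := hk j
        simp only [Fin.rev_rev]
        omega
      · intro g _
        ext i
        simp only [Fin.rev_rev]
        omega
      · intro k hk
        have hg : (fun i : Fin n => k i.rev - (i.rev : ℕ)) ∈ interlacing n μ := by
          simp only [interlacing, Fintype.mem_piFinset, Finset.mem_Icc, Finset.mem_Ico, hrev,
            hrev', Fin.val_castSucc, Fin.val_succ] at hk ⊢
          intro i
          have := hk i.rev
          rw [Fin.rev_rev] at this
          omega
        rw [mul_assoc, ← ih (x ∘ Fin.castSucc) (colLen_rowDiagram_le _)]
        simp only [rowLen_rowDiagram (antitone_of_mem_interlacing hg), Fin.rev_rev]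
        simp only [Fintype.mem_piFinset, Finset.mem_Ico, hrev, hrev', Fin.val_castSucc,
          Fin.val_succ] at hk
        congr 2
        · congr 1
          rw [← Equiv.sum_comp Fin.revPerm]
          refine Finset.sum_congr rfl fun i _ => ?_
          have := hk i.rev
          rw [Fin.rev_rev] at this
          simp only [Fin.revPerm_apply, hrev', Fin.rev_rev, Fin.val_succ]
          omega
        · ext i j
          have := hk j
          simp only [Matrix.of_apply, Function.comp]
          congr 1
          omega
    · intro a b hab
      have h1 := hanti b.rev a.rev (by simp only [Fin.val_rev]; omega)
      have h2 : (a : ℕ) < b := hab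
      simp only
      omega

/-! ### Diagrams encoded by exponents -/

/-- The partition `μ` with `μ_i + n - 1 - i` running through the strictly increasing sequence `k`
from right to left. -/
def betaDiagram {n : ℕ} (k : Fin n → ℕ) : YoungDiagram :=
  rowDiagram fun i : Fin n => k i.rev - i.rev

theorem StrictMono.add_le_add_of_le {n : ℕ} {k : Fin n → ℕ} (hk : StrictMono k) {a b : Fin n}
    (hab : a ≤ b) : k a + b ≤ k b + a := by
  obtain ⟨b, hb⟩ := b
  induction b with
  | zero =>
    have : a = ⟨0, hb⟩ := le_antisymm hab (Nat.zero_le _)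
    rw [this]
  | succ b ih =>
    rcases hab.eq_or_lt with rfl | h
    · exact le_rfl
    · have h1 := ih (by omega) (Nat.le_of_lt_succ h)
      have h2 : k ⟨b, by omega⟩ < k ⟨b + 1, hb⟩ := hk (Nat.lt_succ_self b)
      simp only at h1 ⊢
      omega

theorem StrictMono.val_le_apply {n : ℕ} {k : Fin n → ℕ} (hk : StrictMono k) (a : Fin n) :
    (a : ℕ) ≤ k a := by
  have := hk.add_le_add_of_le (a := ⟨0, a.pos⟩) (b := a) (Nat.zero_le _)
  simp only at this
  omega

theorem colLen_betaDiagram_le {n : ℕ} (k : Fin n → ℕ) : (betaDiagram k).colLen 0 ≤ n :=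
  colLen_rowDiagram_le _

theorem rowLen_betaDiagram {n : ℕ} {k : Fin n → ℕ} (hk : StrictMono k) (j : Fin n) :
    (betaDiagram k).rowLen j.rev + j = k j := by
  rw [betaDiagram, rowLen_rowDiagram, Fin.rev_rev]
  · exact Nat.sub_add_cancel (hk.val_le_apply j)
  · intro a b hab
    have h1 := hk.add_le_add_of_le (Fin.rev_le_rev.mpr hab)
    have h2 := hk.val_le_apply b.rev
    simp only
    omega

theorem strictMono_rowLen_add (μ : YoungDiagram) (n : ℕ) :
    StrictMono fun j : Fin n => μ.rowLen j.rev + j := by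
  intro a b hab
  have h1 := μ.rowLen_anti b.rev a.rev (Fin.rev_le_rev.mpr hab.le)
  have h2 : (a : ℕ) < b := hab
  simp only
  omega

theorem betaDiagram_rowLen_add {n : ℕ} {μ : YoungDiagram} (h : μ.colLen 0 ≤ n) :
    betaDiagram (fun j : Fin n => μ.rowLen j.rev + j) = μ := by
  conv_rhs => rw [eq_rowDiagram h]
  simp [betaDiagram]

theorem det_pow_eq_schurEval {A : Type*} [CommRing A] {n : ℕ} (x : Fin n → A) {k : Fin n → ℕ}
    (hk : StrictMono k) :
    (Matrix.of fun i j : Fin n => x i ^ k j).det =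
      schurEval x (betaDiagram k) * (Matrix.vandermonde x).det := by
  rw [← det_rowLen_eq x (colLen_betaDiagram_le k)]
  simp only [rowLen_betaDiagram hk]

/-! ### Bounded first row -/

/-- The partitions with at most `n` rows and `p` columns. -/
noncomputable def boxDiagrams (n p : ℕ) : Finset YoungDiagram := by
  classical
  exact ((Fintype.piFinset fun _ : Fin n => Finset.range (n + p)).filter StrictMono).image
    betaDiagram

theorem mem_boxDiagrams {n p : ℕ} {μ : YoungDiagram} :
    μ ∈ boxDiagrams n p ↔ μ.rowLen 0 ≤ p ∧ μ.colLen 0 ≤ n := by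
  simp only [boxDiagrams, Finset.mem_image, Finset.mem_filter, Fintype.mem_piFinset,
    Finset.mem_range]
  constructor
  · rintro ⟨k, ⟨hk, hmono⟩, rfl⟩
    refine ⟨?_, colLen_betaDiagram_le k⟩
    rcases Nat.eq_zero_or_pos n with rfl | hn
    · rw [rowLen_eq_zero_of_colLen_le (colLen_betaDiagram_le k)]
      exact Nat.zero_le p
    · have h1 := rowLen_betaDiagram hmono (Fin.rev ⟨0, hn⟩)
      have h2 := hk (Fin.rev ⟨0, hn⟩)
      rw [Fin.rev_rev, Fin.val_rev] at h1
      simp only at h1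
      omega
  · rintro ⟨h1, h2⟩
    refine ⟨fun j => μ.rowLen j.rev + j, ⟨fun j => ?_, strictMono_rowLen_add μ n⟩,
      betaDiagram_rowLen_add h2⟩
    have := μ.rowLen_anti 0 j.rev (Nat.zero_le _)
    have := j.2
    simp only
    omega

theorem altSum_eq {A : Type*} [CommRing A] {n : ℕ} (p : ℕ) (x : Fin n → A) :
    altSum (n + p) x =
      (∑ μ ∈ boxDiagrams n p, schurEval x μ) * (Matrix.vandermonde x).det := by
  classical
  rw [boxDiagrams, Finset.sum_image, altSum, Finset.sum_mul]
  · refine Finset.sum_congr rfl fun k hk => ?_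
    exact det_pow_eq_schurEval x (Finset.mem_filter.mp hk).2
  · intro k hk k' hk' h
    simp only [Finset.coe_filter, Set.mem_ofPred_eq] at hk hk'
    ext j
    rw [← rowLen_betaDiagram hk.2, ← rowLen_betaDiagram hk'.2, h]

/-! ### Frobenius coordinates -/

theorem diag_mem_iff {μ : YoungDiagram} {i : ℕ} : (i, i) ∈ μ ↔ i < diagLen μ := by
  have hex : ∃ i, (i, i) ∉ μ := by
    obtain ⟨j, hj⟩ := μ.exists_notMem_row 0
    exact ⟨j, fun h => hj (μ.up_left_mem (Nat.zero_le _) le_rfl h)⟩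
  have hmem : ∀ i, (i, i) ∈ μ ↔ i < Nat.find hex := by
    intro i
    rw [Nat.lt_find_iff]
    refine ⟨fun h m hm => not_not.mpr (μ.up_left_mem hm hm h), fun h => not_not.mp (h i le_rfl)⟩
  have hcard : diagLen μ = Nat.find hex := by
    have : μ.cells.filter (fun c => c.1 = c.2) =
        (Finset.range (Nat.find hex)).image fun i => (i, i) := by
      ext ⟨a, b⟩
      simp only [Finset.mem_filter, YoungDiagram.mem_cells, Finset.mem_image, Finset.mem_range,
        Prod.mk.injEq]
      constructor
      · rintro ⟨h, rfl⟩
        exact ⟨a, (hmem a).mp h, rfl, rfl⟩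
      · rintro ⟨c, h, rfl, rfl⟩
        exact ⟨(hmem c).mpr h, rfl⟩
    rw [diagLen, this, Finset.card_image_of_injective _ fun a b h => (Prod.mk.inj h).1,
      Finset.card_range]
  rw [hmem, hcard]

theorem lt_rowLen_iff_lt_diagLen {μ : YoungDiagram} {i : ℕ} : i < μ.rowLen i ↔ i < diagLen μ := by
  rw [← diag_mem_iff, YoungDiagram.mem_iff_lt_rowLen]

theorem lt_colLen_iff_lt_diagLen {μ : YoungDiagram} {i : ℕ} : i < μ.colLen i ↔ i < diagLen μ := by
  rw [← diag_mem_iff, YoungDiagram.mem_iff_lt_colLen]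

theorem diagLen_le {n : ℕ} {μ : YoungDiagram} (h : μ.colLen 0 ≤ n) : diagLen μ ≤ n := by
  refine le_of_forall_lt fun i hi => ?_
  have h1 := lt_colLen_iff_lt_diagLen.mpr hi
  have h2 := μ.colLen_anti 0 i (Nat.zero_le i)
  omega

/-- The number of boxes to the right of the `i`-th diagonal box. -/
def arm (μ : YoungDiagram) (i : Fin (diagLen μ)) : ℕ :=
  μ.rowLen i - (i + 1)

/-- The number of boxes below the `i`-th diagonal box. -/
def leg (μ : YoungDiagram) (i : Fin (diagLen μ)) : ℕ :=
  μ.colLen i - (i + 1)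

theorem rowLen_eq_arm (μ : YoungDiagram) (i : Fin (diagLen μ)) :
    μ.rowLen i = i + 1 + arm μ i := by
  have := lt_rowLen_iff_lt_diagLen.mpr i.2
  rw [arm]; omega

theorem colLen_eq_leg (μ : YoungDiagram) (i : Fin (diagLen μ)) :
    μ.colLen i = i + 1 + leg μ i := by
  have := lt_colLen_iff_lt_diagLen.mpr i.2
  rw [leg]; omega

theorem strictAnti_arm (μ : YoungDiagram) : StrictAnti (arm μ) := by
  intro a b hab
  have h1 := μ.rowLen_anti a b hab.le
  have h2 : (a : ℕ) < b := hab
  have h3 := rowLen_eq_arm μ a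
  have h4 := rowLen_eq_arm μ b
  omega

theorem strictAnti_leg (μ : YoungDiagram) : StrictAnti (leg μ) := by
  intro a b hab
  have h1 := μ.colLen_anti a b hab.le
  have h2 : (a : ℕ) < b := hab
  have h3 := colLen_eq_leg μ a
  have h4 := colLen_eq_leg μ b
  omega

theorem mem_augmentedSelfConj_iff {p : ℕ} {μ : YoungDiagram} :
    μ ∈ augmentedSelfConj p ↔ ∀ i, arm μ i = leg μ i + p := by
  constructor
  · rintro ⟨r, α, -, rfl, h⟩ i
    have h1 := h i
    simp only at h1
    have h2 := rowLen_eq_arm μ i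
    have h3 := colLen_eq_leg μ i
    omega
  · intro h
    refine ⟨diagLen μ, leg μ, strictAnti_leg μ, rfl, fun i => ⟨?_, colLen_eq_leg μ i⟩⟩
    rw [rowLen_eq_arm, h]

theorem exists_rowLen_add_eq_iff_arm {n : ℕ} {μ : YoungDiagram} (hμ : μ.colLen 0 ≤ n) (c : ℕ) :
    (∃ j : Fin n, μ.rowLen j.rev + j = n + c) ↔ ∃ i, arm μ i = c := by
  constructor
  · rintro ⟨j, hj⟩
    have h1 := Fin.val_rev j
    have hi : (j.rev : ℕ) < diagLen μ := by
      rw [← lt_rowLen_iff_lt_diagLen]; omega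
    refine ⟨⟨j.rev, hi⟩, ?_⟩
    have := rowLen_eq_arm μ ⟨j.rev, hi⟩
    simp only at this
    omega
  · rintro ⟨i, rfl⟩
    have h1 := i.2.trans_le (diagLen_le hμ)
    refine ⟨Fin.rev ⟨i, h1⟩, ?_⟩
    rw [Fin.rev_rev, Fin.val_rev, rowLen_eq_arm]
    simp only
    omega

theorem card_filter_le_rowLen_add {n : ℕ} {μ : YoungDiagram} (hμ : μ.colLen 0 ≤ n) :
    (Finset.univ.filter fun j : Fin n => n ≤ μ.rowLen j.rev + j).card = diagLen μ := by
  have : (Finset.univ.filter fun j : Fin n => n ≤ μ.rowLen j.rev + j) =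
      Finset.univ.image fun i : Fin (diagLen μ) => Fin.rev ⟨i, i.2.trans_le (diagLen_le hμ)⟩ := by
    ext j
    simp only [Finset.mem_filter, Finset.mem_univ, true_and, Finset.mem_image]
    have h1 := Fin.val_rev j
    constructor
    · intro h
      have hi : (j.rev : ℕ) < diagLen μ := by
        rw [← lt_rowLen_iff_lt_diagLen]; omega
      exact ⟨⟨j.rev, hi⟩, Fin.rev_rev j⟩
    · rintro ⟨i, rfl⟩
      have := lt_rowLen_iff_lt_diagLen.mpr i.2
      rw [Fin.rev_rev, Fin.val_rev]
      simp only
      omega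
  rw [this, Finset.card_image_of_injective, Finset.card_fin]
  intro a b h
  simpa [Fin.ext_iff] using Fin.rev_injective h

theorem leg_lt {n : ℕ} {μ : YoungDiagram} (hμ : μ.colLen 0 ≤ n) (i : Fin (diagLen μ)) :
    leg μ i < n := by
  have := μ.colLen_anti 0 i (Nat.zero_le _)
  have := colLen_eq_leg μ i
  omega

/-- The numbers below `n` missing among `μ_i + n - 1 - i` are the `n - 1 - b`, for `b` a leg
length. -/
theorem forall_rowLen_add_ne_iff_leg {n : ℕ} {μ : YoungDiagram} (hμ : μ.colLen 0 ≤ n)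
    (c : Fin n) :
    (∀ j : Fin n, μ.rowLen j.rev + j ≠ c) ↔ ∃ i, leg μ i = c.rev := by
  have hleg := leg_lt hμ
  set L : Finset (Fin n) := Finset.univ.image fun i => Fin.rev ⟨leg μ i, hleg i⟩
  set M : Finset (Fin n) := Finset.univ.filter fun c => ∀ j : Fin n, μ.rowLen j.rev + j ≠ c
  have hLM : L ⊆ M := by
    intro c hc
    obtain ⟨i, -, rfl⟩ := Finset.mem_image.mp hc
    refine Finset.mem_filter.mpr ⟨Finset.mem_univ _, fun j hj => ?_⟩
    have h0 : ((Fin.rev ⟨leg μ i, hleg i⟩ : Fin n) : ℕ) = n - (leg μ i + 1) := Fin.val_rev _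
    have h1 := colLen_eq_leg μ i
    have h2 := Fin.val_rev j
    -- The box `(j.rev, i)` is compared with the row and the column through it.
    by_cases hmem : ((j.rev : ℕ), (i : ℕ)) ∈ μ
    · have h3 := YoungDiagram.mem_iff_lt_rowLen.mp hmem
      have h4 := YoungDiagram.mem_iff_lt_colLen.mp hmem
      have := hleg i
      omega
    · have h3 := mt YoungDiagram.mem_iff_lt_rowLen.mpr hmem
      have h4 := mt YoungDiagram.mem_iff_lt_colLen.mpr hmem
      have := hleg i
      omega
  have hL : L.card = diagLen μ := by
    rw [Finset.card_image_of_injective, Finset.card_fin]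
    intro a b h
    have := Fin.rev_injective h
    exact (strictAnti_leg μ).injective (by simpa [Fin.ext_iff] using this)
  have hM : M.card ≤ diagLen μ := by
    set Q : Finset (Fin n) := Finset.univ.filter fun j : Fin n => ¬ n ≤ μ.rowLen j.rev + j
    have hQ : Q.card + diagLen μ = n := by
      rw [← card_filter_le_rowLen_add hμ, add_comm, Finset.card_filter_add_card_filter_not,
        Finset.card_fin]
    have hQM : Q.card ≤ Mᶜ.card := by
      refine Finset.card_le_card_of_injOn
        (fun j => if h : μ.rowLen j.rev + j < n then ⟨μ.rowLen j.rev + j, h⟩ else j) ?_ ?_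
      · intro j hj
        have hj' : μ.rowLen j.rev + j < n := not_le.mp (Finset.mem_filter.mp hj).2
        simp only [dif_pos hj', Finset.coe_compl, Set.mem_compl_iff, Finset.mem_coe]
        intro hc
        exact (Finset.mem_filter.mp hc).2 j rfl
      · intro j hj j' hj' h
        have h1 : μ.rowLen j.rev + j < n := not_le.mp (Finset.mem_filter.mp hj).2
        have h2 : μ.rowLen j'.rev + j' < n := not_le.mp (Finset.mem_filter.mp hj').2
        simp only [dif_pos h1, dif_pos h2, Fin.mk.injEq] at h
        exact (strictMono_rowLen_add μ n).injective h
    rw [Finset.card_compl, Fintype.card_fin] at hQM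
    have := Finset.card_le_univ M
    rw [Fintype.card_fin] at this
    omega
  have hEq : L = M := Finset.eq_of_subset_of_card_le hLM (by omega)
  have : c ∈ M ↔ c ∈ L := by rw [hEq]
  simp only [M, L, Finset.mem_filter, Finset.mem_univ, true_and, Finset.mem_image] at this
  rw [this]
  refine exists_congr fun i => ?_
  rw [Fin.rev_eq_iff, Fin.ext_iff]

/-! ### The alternants in the expansion of the numerator -/

/-- The exponents of the alternant contributed by the columns `S` in which the term `x_i ^ j` is
replaced by `x_i ^ (2 n + p - 1 - j)`. -/
def flipExponent {n : ℕ} (p : ℕ) (S : Finset (Fin n)) (j : Fin n) : ℕ :=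
  if j ∈ S then n + p + j.rev else j

theorem flipExponent_lt_iff {n p : ℕ} {S : Finset (Fin n)} {a b : Fin n} (hab : a < b) :
    flipExponent p S a < flipExponent p S b ↔ a ∉ S := by
  have h1 : (a : ℕ) < b := hab
  have h2 := Fin.val_rev a
  have h3 := Fin.val_rev b
  have h4 := b.2
  unfold flipExponent
  split_ifs <;> simp_all <;> omega

theorem injective_flipExponent {n : ℕ} (p : ℕ) (S : Finset (Fin n)) :
    Function.Injective (flipExponent p S) := by
  intro a b h
  unfold flipExponent at h
  have h1 := Fin.val_rev a
  have h2 := Fin.val_rev b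
  have h3 := a.2
  have h4 := b.2
  apply Fin.ext
  split_ifs at h <;> omega

theorem strictMono_flipExponent_sort {n : ℕ} (p : ℕ) (S : Finset (Fin n)) :
    StrictMono (flipExponent p S ∘ Tuple.sort (flipExponent p S)) :=
  (Tuple.monotone_sort _).strictMono_of_injective
    ((injective_flipExponent p S).comp (Equiv.injective _))

/-- The inversions of the sequence of exponents are the pairs `a < b` with `a ∈ S`. -/
theorem sign_sort_flipExponent {n : ℕ} (p : ℕ) (S : Finset (Fin n)) :
    (Tuple.sort (flipExponent p S)).sign = ∏ j ∈ S, (-1) ^ (j.rev : ℕ) := by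
  set σ := Tuple.sort (flipExponent p S) with hσ
  have hlt : ∀ a b, σ⁻¹ a < σ⁻¹ b ↔ flipExponent p S a < flipExponent p S b := by
    intro a b
    have := (strictMono_flipExponent_sort p S).lt_iff_lt (a := σ⁻¹ a) (b := σ⁻¹ b)
    rw [← this]
    simp [← hσ]
  rw [← Equiv.Perm.sign_inv, Equiv.Perm.sign_eq_prod_prod_Ioi]
  have h : ∀ a, ∏ b ∈ Finset.Ioi a, (if σ⁻¹ a < σ⁻¹ b then (1 : ℤˣ) else -1) =
      if a ∈ S then (-1) ^ (a.rev : ℕ) else 1 := by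
    intro a
    have : ∀ b ∈ Finset.Ioi a, (if σ⁻¹ a < σ⁻¹ b then (1 : ℤˣ) else -1) =
        if a ∈ S then -1 else 1 := by
      intro b hb
      simp only [hlt, flipExponent_lt_iff (Finset.mem_Ioi.mp hb), ite_not]
    rw [Finset.prod_congr rfl this, Finset.prod_const, Fin.card_Ioi, ite_pow, one_pow,
      Fin.val_rev]
    congr 2
    omega
  rw [Finset.prod_congr rfl fun a _ => h a, Finset.prod_ite_mem, Finset.univ_inter]

/-- The partition belonging to the exponents `flipExponent p S`. -/
def flipDiagram {n : ℕ} (p : ℕ) (S : Finset (Fin n)) : YoungDiagram :=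
  betaDiagram (flipExponent p S ∘ Tuple.sort (flipExponent p S))

theorem rowLen_flipDiagram {n : ℕ} (p : ℕ) (S : Finset (Fin n)) (j : Fin n) :
    (flipDiagram p S).rowLen j.rev + j = flipExponent p S (Tuple.sort (flipExponent p S) j) :=
  rowLen_betaDiagram (strictMono_flipExponent_sort p S) j

theorem colLen_flipDiagram_le {n : ℕ} (p : ℕ) (S : Finset (Fin n)) :
    (flipDiagram p S).colLen 0 ≤ n :=
  colLen_betaDiagram_le _

theorem det_flipExponent {A : Type*} [CommRing A] {n : ℕ} (p : ℕ) (x : Fin n → A)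
    (S : Finset (Fin n)) :
    (Matrix.of fun i j => x i ^ flipExponent p S j).det =
      (∏ j ∈ S, (-1) ^ (j.rev : ℕ)) *
        (schurEval x (flipDiagram p S) * (Matrix.vandermonde x).det) := by
  set σ := Tuple.sort (flipExponent p S) with hσ
  have h := Matrix.det_permute' σ (Matrix.of fun i j => x i ^ flipExponent p S j)
  have h2 : (Matrix.of fun i j => x i ^ flipExponent p S j).submatrix id σ =
      Matrix.of fun i j => x i ^ (flipExponent p S ∘ σ) j := by
    ext i j; simp
  rw [h2, det_pow_eq_schurEval x (strictMono_flipExponent_sort p S), sign_sort_flipExponent] at h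
  rw [flipDiagram, h, ← mul_assoc]
  push_cast
  rw [← Finset.prod_mul_distrib, Finset.prod_eq_one, one_mul]
  intro j _
  rw [← mul_pow]; simp

/-- The expansion of `altB` along the columns. -/
theorem altB_eq_sum_schurEval {A : Type*} [CommRing A] {n : ℕ} (p : ℕ) (x : Fin n → A) :
    altB (n + p) x = (∑ S : Finset (Fin n),
      (∏ j ∈ S, (-1) ^ ((j.rev : ℕ) + 1)) * schurEval x (flipDiagram p S)) *
        (Matrix.vandermonde x).det := by
  have h := (Matrix.detRowAlternating (n := Fin n) (R := A)).map_add_univ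
    (fun (j : Fin n) i => -x i ^ (n + p + (j.rev : ℕ))) (fun (j : Fin n) i => x i ^ (j : ℕ))
  have h1 : altB (n + p) x = Matrix.detRowAlternating (n := Fin n) (R := A)
      ((fun (j : Fin n) i => -x i ^ (n + p + (j.rev : ℕ))) +
        (fun (j : Fin n) i => x i ^ (j : ℕ))) := by
    rw [altB, ← Matrix.det_transpose]
    congr 1
    ext i j
    simp [sub_eq_neg_add]
  rw [h1, h, Finset.sum_mul]
  refine Finset.sum_congr rfl fun S _ => ?_
  simp only [pow_succ, Finset.prod_mul_distrib]
  rw [mul_assoc, mul_right_comm, ← det_flipExponent, mul_comm]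
  have h2 : (∏ _j ∈ S, (-1 : A)) = ∏ j, if j ∈ S then -1 else 1 := by
    rw [Finset.prod_ite_mem, Finset.univ_inter]
  rw [h2, ← Matrix.det_mul_row, ← Matrix.det_transpose]
  change Matrix.det _ = Matrix.det _
  congr 1
  ext i j
  by_cases hi : i ∈ S <;> simp [hi, flipExponent]

theorem exists_flipExponent_eq_val_iff {n p : ℕ} {S : Finset (Fin n)} (c : Fin n) :
    (∃ j, flipExponent p S j = c) ↔ c ∉ S := by
  constructor
  · rintro ⟨j, hj⟩ hc
    have := c.2
    unfold flipExponent at hj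
    split_ifs at hj with hjS
    · omega
    · exact hjS (Fin.ext hj ▸ hc)
  · intro hc
    exact ⟨c, by simp [flipExponent, hc]⟩

theorem exists_flipExponent_eq_add_iff {n p : ℕ} {S : Finset (Fin n)} (c : ℕ) :
    (∃ j, flipExponent p S j = n + c) ↔ ∃ j ∈ S, p + (j.rev : ℕ) = c := by
  refine exists_congr fun j => ?_
  have := j.2
  unfold flipExponent
  split_ifs with hj
  · simp only [hj, true_and]
    omega
  · simp only [hj, false_and, iff_false]
    omega

theorem exists_rowLen_flipDiagram_iff {n p : ℕ} {S : Finset (Fin n)} (c : ℕ) :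
    (∃ j : Fin n, (flipDiagram p S).rowLen j.rev + j = c) ↔ ∃ j, flipExponent p S j = c := by
  simp only [rowLen_flipDiagram]
  exact ((Tuple.sort (flipExponent p S)).surjective.exists
    (p := fun j => flipExponent p S j = c)).symm

theorem injective_flipDiagram (n p : ℕ) :
    Function.Injective (flipDiagram p : Finset (Fin n) → YoungDiagram) := by
  intro S S' h
  ext c
  rw [← not_iff_not, ← exists_flipExponent_eq_val_iff (p := p),
    ← exists_flipExponent_eq_val_iff (p := p), ← exists_rowLen_flipDiagram_iff,
    ← exists_rowLen_flipDiagram_iff, h]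

/-- The legs of `flipDiagram p S` are the numbers `n - 1 - j` and its arms the numbers
`n - 1 - j + p`, for `j ∈ S`. -/
theorem flipDiagram_mem (n p : ℕ) (S : Finset (Fin n)) :
    flipDiagram p S ∈ augmentedSelfConj p := by
  set η := flipDiagram p S
  have hcol : η.colLen 0 ≤ n := colLen_flipDiagram_le p S
  have hS : ∀ d : Fin n, d ∈ S ↔ ∃ i, leg η i = d.rev := by
    intro d
    rw [← forall_rowLen_add_ne_iff_leg hcol, ← not_iff_not,
      ← exists_flipExponent_eq_val_iff (p := p), ← exists_rowLen_flipDiagram_iff]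
    simp [η]
  have hleg : ∀ c, (∃ i, leg η i = c) ↔ ∃ j ∈ S, (j.rev : ℕ) = c := by
    intro c
    constructor
    · rintro ⟨i, rfl⟩
      refine ⟨Fin.rev ⟨leg η i, leg_lt hcol i⟩, (hS _).mpr ⟨i, ?_⟩, ?_⟩ <;> rw [Fin.rev_rev]
    · rintro ⟨j, hj, rfl⟩
      exact (hS j).mp hj
  have harm : ∀ c, (∃ i, arm η i = c) ↔ ∃ j ∈ S, p + (j.rev : ℕ) = c := by
    intro c
    rw [← exists_rowLen_add_eq_iff_arm hcol, exists_rowLen_flipDiagram_iff,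
      exists_flipExponent_eq_add_iff]
  rw [mem_augmentedSelfConj_iff]
  refine congrFun ((StrictAnti.range_inj (strictAnti_arm η)
    (fun a b hab => Nat.add_lt_add_right (strictAnti_leg η hab) p)).mp ?_)
  ext c
  rw [Set.mem_range, harm]
  constructor
  · rintro ⟨j, hj, rfl⟩
    obtain ⟨i, hi⟩ := (hleg _).mpr ⟨j, hj, rfl⟩
    exact ⟨i, by simp only; omega⟩
  · rintro ⟨i, rfl⟩
    obtain ⟨j, hj, h⟩ := (hleg _).mp ⟨i, rfl⟩
    exact ⟨j, hj, by simp only; omega⟩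

/-- The set `S` consists of the numbers below `n` missing among `η_i + n - 1 - i`. -/
theorem exists_flipDiagram_eq {n p : ℕ} {η : YoungDiagram} (hη : η ∈ augmentedSelfConj p)
    (hcol : η.colLen 0 ≤ n) : ∃ S : Finset (Fin n), flipDiagram p S = η := by
  classical
  rw [mem_augmentedSelfConj_iff] at hη
  set b : Fin n → ℕ := fun j => η.rowLen j.rev + j with hb
  refine ⟨Finset.univ.filter fun c : Fin n => ∀ j, b j ≠ c, ?_⟩
  set S := Finset.univ.filter fun c : Fin n => ∀ j, b j ≠ c with hS
  have hrange : Set.range (flipExponent p S) = Set.range b := by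
    have hmem : ∀ c : Fin n, c ∈ S ↔ ∃ i, leg η i = c.rev := fun c => by
      rw [← forall_rowLen_add_ne_iff_leg hcol]
      simp [S, b]
    ext v
    rw [Set.mem_range, Set.mem_range]
    rcases lt_or_ge v n with hv | hv
    · have := exists_flipExponent_eq_val_iff (p := p) (S := S) ⟨v, hv⟩
      rw [this]
      simp [S]
    · obtain ⟨c, rfl⟩ := Nat.exists_eq_add_of_le hv
      rw [exists_flipExponent_eq_add_iff, exists_rowLen_add_eq_iff_arm hcol]
      constructor
      · rintro ⟨j, hj, rfl⟩
        obtain ⟨i, hi⟩ := (hmem j).mp hj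
        exact ⟨i, by rw [hη, hi, add_comm]⟩
      · rintro ⟨i, rfl⟩
        refine ⟨Fin.rev ⟨leg η i, leg_lt hcol i⟩, (hmem _).mpr ⟨i, ?_⟩, ?_⟩
        · rw [Fin.rev_rev]
        · rw [Fin.rev_rev, hη, add_comm]
  have : flipExponent p S ∘ Tuple.sort (flipExponent p S) = b := by
    rw [← StrictMono.range_inj (strictMono_flipExponent_sort p S) (strictMono_rowLen_add η n),
      (Tuple.sort (flipExponent p S)).surjective.range_comp, hrange]
  rw [flipDiagram, this]
  exact betaDiagram_rowLen_add hcol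

theorem diagLen_flipDiagram {n : ℕ} (p : ℕ) (S : Finset (Fin n)) :
    diagLen (flipDiagram p S) = S.card := by
  rw [← card_filter_le_rowLen_add (colLen_flipDiagram_le p S)]
  simp only [rowLen_flipDiagram]
  have h : S = Finset.univ.filter fun j => n ≤ flipExponent p S j := by
    ext j
    have := j.2
    rw [Finset.mem_filter, flipExponent]
    split_ifs with hj
    · simp [hj]; omega
    · simp [hj]
  conv_rhs => rw [h]
  refine Finset.card_equiv (Tuple.sort (flipExponent p S)) fun j => ?_
  simp

theorem card_flipDiagram {n : ℕ} (p : ℕ) (S : Finset (Fin n)) :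
    (flipDiagram p S).card = ∑ j ∈ S, (p + 1 + 2 * (j.rev : ℕ)) := by
  have h1 : ∑ j : Fin n, ((flipDiagram p S).rowLen j.rev + (j : ℕ)) =
      ∑ j, flipExponent p S j := by
    simp only [rowLen_flipDiagram]
    exact Equiv.sum_comp _ _
  have h2 : ∑ j, flipExponent p S j =
      ∑ j : Fin n, (j : ℕ) + ∑ j ∈ S, (p + 1 + 2 * (j.rev : ℕ)) := by
    have : ∑ j ∈ S, (p + 1 + 2 * (j.rev : ℕ)) =
        ∑ j, if j ∈ S then (p + 1 + 2 * (j.rev : ℕ)) else 0 := by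
      rw [Finset.sum_ite_mem, Finset.univ_inter]
    rw [this, ← Finset.sum_add_distrib]
    refine Finset.sum_congr rfl fun j _ => ?_
    have := Fin.val_rev j
    have := j.2
    unfold flipExponent
    split_ifs <;> omega
  have h3 : ∑ j : Fin n, (flipDiagram p S).rowLen j.rev = ∑ i : Fin n, (flipDiagram p S).rowLen i :=
    Equiv.sum_comp Fin.revPerm fun i : Fin n => (flipDiagram p S).rowLen i
  rw [Finset.sum_add_distrib, h3] at h1
  rw [card_eq_sum_rowLen (colLen_flipDiagram_le p S)]
  omega

/-! ### The character identity -/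

/-- The partitions of `augmentedSelfConj p` with at most `n` rows. -/
noncomputable def flipDiagrams (n p : ℕ) : Finset YoungDiagram := by
  classical
  exact (Finset.univ : Finset (Finset (Fin n))).image (flipDiagram p)

theorem mem_flipDiagrams {n p : ℕ} {η : YoungDiagram} :
    η ∈ flipDiagrams n p ↔ η ∈ augmentedSelfConj p ∧ η.colLen 0 ≤ n := by
  simp only [flipDiagrams, Finset.mem_image, Finset.mem_univ, true_and]
  constructor
  · rintro ⟨S, rfl⟩
    exact ⟨flipDiagram_mem n p S, colLen_flipDiagram_le p S⟩
  · rintro ⟨h1, h2⟩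
    exact exists_flipDiagram_eq h1 h2

theorem card_flipDiagram_sub {n : ℕ} (p : ℕ) (S : Finset (Fin n)) :
    ((flipDiagram p S).card : ℤ) - ((p : ℤ) - 1) * (diagLen (flipDiagram p S) : ℤ) =
      2 * ((∑ j ∈ S, ((j.rev : ℕ) + 1) : ℕ) : ℤ) := by
  rw [diagLen_flipDiagram, card_flipDiagram]
  push_cast
  simp only [Finset.sum_add_distrib, ← Finset.mul_sum, Finset.sum_const, nsmul_eq_mul]
  ring

theorem two_dvd_card_sub {p : ℕ} {η : YoungDiagram} (hη : η ∈ augmentedSelfConj p) :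
    (2 : ℤ) ∣ (η.card : ℤ) - ((p : ℤ) - 1) * (diagLen η : ℤ) := by
  obtain ⟨S, hS⟩ := exists_flipDiagram_eq hη le_rfl
  have h := card_flipDiagram_sub p S
  rw [hS] at h
  rw [h]
  exact dvd_mul_right _ _

/-- The sign with which `η` enters the character identity. -/
def frobeniusSign (p : ℕ) (η : YoungDiagram) : ℤˣ :=
  Int.negOnePow (((η.card : ℤ) - ((p : ℤ) - 1) * (diagLen η : ℤ)) / 2)

theorem frobeniusSign_flipDiagram {n : ℕ} (p : ℕ) (S : Finset (Fin n)) :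
    frobeniusSign p (flipDiagram p S) = ∏ j ∈ S, (-1) ^ ((j.rev : ℕ) + 1) := by
  rw [frobeniusSign, card_flipDiagram_sub, Int.mul_ediv_cancel_left _ two_ne_zero,
    Finset.prod_pow_eq_pow_sum, Int.negOnePow_def, zpow_natCast]

theorem altB_eq_sum_flipDiagrams {A : Type*} [CommRing A] {n : ℕ} (p : ℕ) (x : Fin n → A) :
    altB (n + p) x = (∑ η ∈ flipDiagrams n p, frobeniusSign p η • schurEval x η) *
      (Matrix.vandermonde x).det := by
  classical
  rw [altB_eq_sum_schurEval, flipDiagrams, Finset.sum_image (injective_flipDiagram n p).injOn]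
  congr 1
  refine Finset.sum_congr rfl fun S _ => ?_
  rw [frobeniusSign_flipDiagram, Units.smul_def, zsmul_eq_mul]
  push_cast
  rfl

/-- The character identity at a point in general position over a field. -/
theorem sum_schurEval_eq_of_field {K : Type*} [Field K] {n : ℕ} (p : ℕ) (x : Fin n → K)
    (hinj : Function.Injective x) (h0 : ∀ i, x i ≠ 0) (h1 : ∀ i, x i ≠ -1) :
    ∑ η ∈ flipDiagrams n p, frobeniusSign p η • schurEval x η =
      denomB x * ∑ μ ∈ boxDiagrams n p, schurEval x μ := by
  refine mul_right_cancel₀ (Matrix.det_vandermonde_ne_zero_iff.mpr hinj) ?_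
  rw [← altB_eq_sum_flipDiagrams, ← altSum_mul_denomB (n + p) x hinj h0 h1, altSum_eq]
  ring

theorem map_denomB {A B : Type*} [CommRing A] [CommRing B] (φ : A →+* B) {n : ℕ} (x : Fin n → A) :
    φ (denomB x) = denomB (φ ∘ x) := by
  simp [denomB, map_prod]

theorem map_frobeniusSum {A B : Type*} [CommRing A] [CommRing B] (φ : A →+* B) {n : ℕ} (p : ℕ)
    (x : Fin n → A) :
    φ (∑ η ∈ flipDiagrams n p, frobeniusSign p η • schurEval x η) =
      ∑ η ∈ flipDiagrams n p, frobeniusSign p η • schurEval (φ ∘ x) η := by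
  simp only [map_sum, Units.smul_def, map_zsmul, map_schurEval]

/-- The character identity at an arbitrary point over a commutative ring. -/
theorem sum_schurEval_eq {A : Type*} [CommRing A] {n : ℕ} (p : ℕ) (x : Fin n → A) :
    ∑ η ∈ flipDiagrams n p, frobeniusSign p η • schurEval x η =
      denomB x * ∑ μ ∈ boxDiagrams n p, schurEval x μ := by
  set P := MvPolynomial (Fin n) ℤ
  -- The identity holds for the variables over `ℤ`, as these are in general position.
  have hZ : ∑ η ∈ flipDiagrams n p, frobeniusSign p η • schurEval (MvPolynomial.X : Fin n → P) η =
      denomB (MvPolynomial.X : Fin n → P) * ∑ μ ∈ boxDiagrams n p, schurEval MvPolynomial.X μ := by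
    have hφ := IsFractionRing.injective P (FractionRing P)
    apply hφ
    rw [map_frobeniusSum, map_mul, map_denomB, map_sum]
    simp only [map_schurEval]
    refine sum_schurEval_eq_of_field p _ (hφ.comp (MvPolynomial.X_injective)) (fun i => ?_)
      fun i => ?_
    · simp [P, MvPolynomial.X_ne_zero]
    · rw [Function.comp, ← map_one (algebraMap P (FractionRing P)), ← map_neg]
      refine hφ.ne fun h => ?_
      have := congrArg (MvPolynomial.eval fun _ => (0 : ℤ)) h
      simp at this
  have h := congrArg (MvPolynomial.aeval x : P →ₐ[ℤ] A).toRingHom hZ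
  rw [map_frobeniusSum, map_mul, map_denomB, map_sum] at h
  simp only [map_schurEval] at h
  have hx : (MvPolynomial.aeval x : P →ₐ[ℤ] A).toRingHom ∘ MvPolynomial.X = x := by
    ext i; simp
  rwa [hx] at h

theorem colLen_le_of_schurPoly_ne_zero {R : Type*} [CommRing R] {n : ℕ} {μ : YoungDiagram}
    (h : schurPoly R n μ ≠ 0) : μ.colLen 0 ≤ n :=
  not_lt.mp fun hn => h (schurEval_eq_zero _ hn)

/-- Only diagrams with at most `n` rows contribute to the sums over all partitions. -/
theorem finsum_mem_eq_sum_of_colLen {M : Type*} [AddCommMonoid M] {n : ℕ} {s : Set YoungDiagram}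
    {t : Finset YoungDiagram} (ht : ∀ μ, μ ∈ t ↔ μ ∈ s ∧ μ.colLen 0 ≤ n) {f : YoungDiagram → M}
    (hf : ∀ μ, f μ ≠ 0 → μ.colLen 0 ≤ n) :
    ∑ᶠ (μ : YoungDiagram) (_ : μ ∈ s), f μ = ∑ μ ∈ t, f μ := by
  refine finsum_mem_eq_sum_of_inter_support_eq f ?_
  ext μ
  simp only [Set.mem_inter_iff, Function.mem_support, Finset.mem_coe, ht]
  exact ⟨fun h => ⟨⟨h.1, hf μ h.2⟩, h.2⟩, fun h => ⟨h.1.1, h.2⟩⟩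

theorem mainTheorem4 (R : Type*) [CommRing R] (n p : ℕ) :
    -- the exponents of the signs are integers
    (∀ η ∈ augmentedSelfConj p, (2 : ℤ) ∣ (η.card : ℤ) - ((p : ℤ) - 1) * (diagLen η : ℤ)) ∧
    -- both sums have only finitely many nonzero terms
    {η : YoungDiagram | η ∈ augmentedSelfConj p ∧ schurPoly R n η ≠ 0}.Finite ∧
    {μ : YoungDiagram | μ.rowLen 0 ≤ p ∧ schurPoly R n μ ≠ 0}.Finite ∧
    -- the character identity
    ∑ᶠ (η : YoungDiagram) (_ : η ∈ augmentedSelfConj p),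
        Int.negOnePow (((η.card : ℤ) - ((p : ℤ) - 1) * (diagLen η : ℤ)) / 2) • schurPoly R n η =
      (∏ i : Fin n, (1 - MvPolynomial.X i)) *
        (∏ i : Fin n, ∏ j ∈ Finset.Ioi i, (1 - MvPolynomial.X i * MvPolynomial.X j)) *
        ∑ᶠ (μ : YoungDiagram) (_ : μ.rowLen 0 ≤ p), schurPoly R n μ := by
  refine ⟨fun η => two_dvd_card_sub, ?_, ?_, ?_⟩
  · refine (flipDiagrams n p).finite_toSet.subset ?_
    rintro η ⟨h1, h2⟩
    exact mem_flipDiagrams.mpr ⟨h1, colLen_le_of_schurPoly_ne_zero h2⟩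
  · refine (boxDiagrams n p).finite_toSet.subset ?_
    rintro μ ⟨h1, h2⟩
    exact mem_boxDiagrams.mpr ⟨h1, colLen_le_of_schurPoly_ne_zero h2⟩
  · have h := sum_schurEval_eq p (MvPolynomial.X : Fin n → MvPolynomial (Fin n) R)
    rw [denomB] at h
    refine Eq.trans ?_ (h.trans ?_)
    · refine finsum_mem_eq_sum_of_colLen (n := n) (fun _ => mem_flipDiagrams) fun η hη => ?_
      exact colLen_le_of_schurPoly_ne_zero (right_ne_zero_of_smul hη)
    · congr 1
      exact (finsum_mem_eq_sum_of_colLen (n := n) (s := {μ | μ.rowLen 0 ≤ p})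
        (fun _ => mem_boxDiagrams) fun μ hμ => colLen_le_of_schurPoly_ne_zero hμ).symm
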